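/- Let $A$ be the mod $2$ Steenrod algebra, dual to $A_*=\mathbb F_2[\xi_1,\xi_2,\dots]$ with $\Delta\xi_n=\sum_{i+j=n}\xi_i^{2^j}\otimes\xi_j$ ($\xi_0=1$), with Milnor basis $\mathrm{Sq}(R)$ dual to $\xi^R$. Let $\Delta_t$ be the exponent sequence with $\xi^{\Delta_t}=\xi_t$, and $P_t^s=\mathrm{Sq}(2^s\Delta_t)$. For $a\in A$, $p\in A_*$ let $\mathrm{cont}(p,a)\in A$ be given by $\langle\mathrm{cont}(p,a),q\rangle=\langle a,pq\rangle$. Let $D_0$ be the (graded) dual of $\mathbb Z/4[\xi_n,2\xi_{k,l}]$ $(0\le k<l)$, with product dual to the coproduct that expresses composition modulo $4$ of power series $\sum_{k\ge0}\xi_kx^{2^k}+\sum_{0\le k<l}2\xi_{k,l}x^{2^k+2^l}$. Thus $D_0=\mathbb Z/4\{\mathrm{Sq}(R)\}\oplus\sum_{-1\le k<l}Y_{k,l}A$, with $\mathrm{Sq}(R)$ and $Y_{k,l}\mathrm{Sq}(R)$ dual to $\xi^R$ and $2\xi_{k+1,l+1}\xi^R$. Let $\pi:D_0\to A$ be the projection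 $\mathrm{Sq}(R)\mapsto\mathrm{Sq}(R)$, $Y_{k,l}a\mapsto0$, and $R_D=\ker\pi$. Let $D_1=(A+\mu_0A+\sum_{-1\le k,\,0\le l}U_{k,l}A)/{\sim}=A\oplus\mu_0A\oplus\bigoplus_{-1\le k<l}U_{k,l}A$, where $U_{k,l}=U_{l,k}+\mathrm{Sq}(\Delta_{k+1}+\Delta_{l+1})$ for $l<k$ and $U_{k,k}=\mu_0\mathrm{Sq}(\Delta_{k+2})+\mathrm{Sq}(2\Delta_{k+1})$, an $A$-bimodule with $$a\mu_0=\mu_0a+\mathrm{cont}(\xi_1,a),\qquad aU_{k,l}=\sum_{i,j\ge0}U_{k+i,l+j}\,\mathrm{cont}(\xi_i^{2^{k+1}}\xi_j^{2^{l+1}},a).$$ Let $\partial:D_1\to D_0$ be given by $\partial a=0$, $\partial(\mu_0a)=2a$, $\partial(U_{k,l}a)=Y_{k,l}a$. For sections $\sigma:A\to D_0$ of $\pi$ (with $\sigma(0)=0$) and $u:R_D\to D_1$ of $\partial$ ($u$ additive), put $\tau(a,b)=u(\sigma(ab)-\sigma(a)\sigma(b))$ and $$\langle a,b,c\rangle_{\sigma,u}=\tau(ab,c)-\tau(a,b)\sigma(c)-\tau(a,bc)+\sigma(a)\tau(b,c)\in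 D_1,$$ where $D_0$ acts on $D_1$ through $\pi$. The Massey product $\langle a,b,c\rangle\subseteq A$ is the set of values $\langle a,b,c\rangle_{\sigma,u}\in A\subset D_1$ for all choices of $(\sigma,u)$. The standard sections are $\sigma(\sum c_i\mathrm{Sq}(R_i))=\sum\widehat{c_i}\,\mathrm{Sq}(R_i)$ with $\widehat0=0$, $\widehat1=1\in\mathbb Z/4$, and $u(2\mathrm{Sq}(R))=\mu_0\mathrm{Sq}(R)$, $u(Y_{k,l}\mathrm{Sq}(R))=U_{k,l}\mathrm{Sq}(R)$ for $k<l$. **Corollary.** Let $t\ge1$. 1. If $s\ge 0$ and $s<t-1$, then $\langle P_t^s,P_t^s,P_t^s\rangle$ is zero: with the standard sections it equals $0$, and so $0\in\langle P_t^s,P_t^s,P_t^s\rangle$. 2. If $t\ge2$, then with the standard sections $\langle P_t^{t-1},P_t^{t-1},P_t^{t-1}\rangle$ equals $\mathrm{Sq}\big((2^{t-1}-1)\Delta_t+2\Delta_{2t-1}\big)$, and so $$\langle P_t^{t-1},P_t^{t-1},P_t^{t-1}\rangle\ni\mathrm{Sq}\big((2^{t-1}-1)\Delta_t+2\Delta_{2t-1}\big).$$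 For $t=1$, the product $\langle P_1^0,P_1^0,P_1^0\rangle=\langle\mathrm{Sq}^1,\mathrm{Sq}^1,\mathrm{Sq}^1\rangle$ is zero in the sense of 1. The case $t=2$ of 2 is the Kristensen–Madsen computation $\langle\mathrm{Sq}(0,2),\mathrm{Sq}(0,2),\mathrm{Sq}(0,2)\rangle\ni\mathrm{Sq}(0,1,2)$, with equality for the standard sections. -/

import Mathlib

namespace SecondarySteenrod

open MvPolynomial

noncomputable section

/-! ## Finiteness and homogeneity facts for dual algebras of polynomial coalgebras -/

/-- The value of `x ⊗ y` on `q`, where `x`, `y` are finite linear combinations of the functionals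
dual to the monomials of `k[σ]`, and `k[σ] ⊗ k[σ]` is written as the polynomial ring `k[σ ⊕ σ]`
(left tensor factor: `Sum.inl`, right tensor factor: `Sum.inr`). -/
def pair2 {σ k : Type*} [CommRing k] (x y : (σ →₀ ℕ) →₀ k) (q : MvPolynomial (σ ⊕ σ) k) : k :=
  x.sum fun m a => y.sum fun n b => a * b * coeff (m.sumElim n) q

theorem pair2_bound {σ k : Type*} [CommRing k] (w : σ → ℕ) (x y : (σ →₀ ℕ) →₀ k) :
    ∃ B : ℕ, ∀ (q : MvPolynomial (σ ⊕ σ) k) (N : ℕ),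
      IsWeightedHomogeneous (Sum.elim w w) q N → pair2 x y q ≠ 0 → N ≤ B := by
  refine ⟨x.support.sup (Finsupp.weight w) + y.support.sup (Finsupp.weight w), ?_⟩
  intro q N hq hne
  obtain ⟨m, hm, h1⟩ := Finset.exists_ne_zero_of_sum_ne_zero hne
  obtain ⟨n, hn, h2⟩ := Finset.exists_ne_zero_of_sum_ne_zero h1
  have h3 : coeff (m.sumElim n) q ≠ 0 := fun h => h2 (by simp [h])
  have h4 := hq h3
  have h5 : Finsupp.weight (Sum.elim w w) (m.sumElim n)
      = Finsupp.weight w m + Finsupp.weight w n := by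
    simp only [Finsupp.weight_apply]
    exact Finsupp.prod_sumElim (M := Multiplicative ℕ) m n
      (fun i c => Multiplicative.ofAdd (c • Sum.elim w w i))
  have h6 : Finsupp.weight w m ≤ x.support.sup (Finsupp.weight w) :=
    Finset.le_sup (f := Finsupp.weight w) hm
  have h7 : Finsupp.weight w n ≤ y.support.sup (Finsupp.weight w) :=
    Finset.le_sup (f := Finsupp.weight w) hn
  omega

theorem homogeneous_aeval {σ τ k : Type*} [CommRing k] (w : σ → ℕ) (w' : τ → ℕ)
    (f : σ → MvPolynomial τ k) (hf : ∀ i, IsWeightedHomogeneous w' (f i) (w i)) (m : σ →₀ ℕ) :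
    IsWeightedHomogeneous w' (aeval f (monomial m (1 : k))) (Finsupp.weight w m) := by
  rw [aeval_monomial, map_one, one_mul, Finsupp.weight_apply]
  exact IsWeightedHomogeneous.prod _ _ _ fun i _ => by
    simpa using (hf i).pow (m i)

theorem finite_weight_le {σ : Type*} (w : σ → ℕ) (hw : ∀ i, w i ≠ 0)
    (hfin : ∀ N, {i | w i ≤ N}.Finite) (N : ℕ) :
    {m : σ →₀ ℕ | Finsupp.weight w m ≤ N}.Finite := by
  classical
  refine Set.Finite.subset
    (Finset.finite_toSet ((hfin N).toFinset.finsupp fun _ => Finset.range (N + 1))) ?_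
  intro m hm
  simp only [Finset.mem_coe, Finset.mem_finsupp_iff]
  constructor
  · intro i hi
    rw [Set.Finite.mem_toFinset]
    exact (Finsupp.le_weight_of_ne_zero' w (Finsupp.mem_support_iff.1 hi)).trans hm
  · intro i _
    have := (Finsupp.le_weight w (hw i) m).trans hm
    simp only [Finset.mem_range]
    omega

/-! ## The Steenrod algebra -/

/-- Exponent sequences `R = (r₁, r₂, …)`; the entry `r_{n+1}` is `R n`. -/
abbrev Exponent := ℕ →₀ ℕ

/-- `Δ_n`, the exponent sequence with `ξ^{Δ_n} = ξ_n`, where `ξ_0 = 1`. -/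
def expDelta : ℕ → Exponent
  | 0 => 0
  | n + 1 => Finsupp.single n 1

/-- `ξ_n` with `ξ_0 = 1`, if `ξ_{n+1}` is given by `v n`. -/
def xi {K : Type*} [CommRing K] (v : ℕ → K) : ℕ → K
  | 0 => 1
  | n + 1 => v n

/-- `ξ_{n-k}`, which is zero for `k > n`. -/
def xiSub {K : Type*} [CommRing K] (v : ℕ → K) (n k : ℕ) : K :=
  if k ≤ n then xi v (n - k) else 0

/-- The degree `2^{n+1} - 1` of `ξ_{n+1}`. -/
def wtA (n : ℕ) : ℕ := 2 ^ (n + 1) - 1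

/-- The coproduct of the dual Steenrod algebra `A_* = 𝔽₂[ξ₁, ξ₂, …]`:
`Δ ξ_n = ∑_{i+j=n} ξ_i^{2^j} ⊗ ξ_j`. -/
def coprodA : MvPolynomial ℕ (ZMod 2) →ₐ[ZMod 2] MvPolynomial (ℕ ⊕ ℕ) (ZMod 2) :=
  aeval fun n => ∑ j ∈ Finset.range (n + 2),
    xiSub (fun i => X (Sum.inl i)) (n + 1) j ^ 2 ^ j * xi (fun i => X (Sum.inr i)) j

theorem homogeneous_xi {τ k : Type*} [CommRing k] (w : τ → ℕ) (f : ℕ → τ)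
    (hf : ∀ n, w (f n) = wtA n) (n : ℕ) :
    IsWeightedHomogeneous w (xi (fun i => (X (f i) : MvPolynomial τ k)) n) (2 ^ n - 1) := by
  cases n with
  | zero => simpa [xi] using isWeightedHomogeneous_one k w
  | succ n => simpa [xi, hf, wtA] using isWeightedHomogeneous_X k w (f n)

theorem homogeneous_xiSub {τ k : Type*} [CommRing k] (w : τ → ℕ) (f : ℕ → τ)
    (hf : ∀ n, w (f n) = wtA n) (n j : ℕ) :
    IsWeightedHomogeneous w (xiSub (fun i => (X (f i) : MvPolynomial τ k)) n j ^ 2 ^ j)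
      (2 ^ n - 2 ^ j) := by
  unfold xiSub
  split_ifs with h
  · have := (homogeneous_xi (k := k) w f hf (n - j)).pow (2 ^ j)
    convert this using 1
    rw [smul_eq_mul, Nat.mul_sub, mul_one, ← pow_add]
    congr 2
    omega
  · rw [zero_pow (by positivity)]
    exact isWeightedHomogeneous_zero _ _ _

theorem homogeneous_coprodA (m : Exponent) :
    IsWeightedHomogeneous (Sum.elim wtA wtA) (coprodA (monomial m 1)) (Finsupp.weight wtA m) := by
  refine homogeneous_aeval _ _ _ (fun n => ?_) m
  refine IsWeightedHomogeneous.sum _ _ _ fun j hj => ?_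
  have h1 := homogeneous_xiSub (k := ZMod 2) (Sum.elim wtA wtA) Sum.inl (fun _ => rfl) (n + 1) j
  have h2 := homogeneous_xi (k := ZMod 2) (Sum.elim wtA wtA) Sum.inr (fun _ => rfl) j
  convert h1.mul h2 using 1
  have h3 : 2 ^ j ≤ 2 ^ (n + 1) :=
    Nat.pow_le_pow_right (by norm_num) (by simp only [Finset.mem_range] at hj; omega)
  have h4 : 1 ≤ 2 ^ j := Nat.one_le_two_pow
  simp only [wtA]
  omega

theorem le_wtA (n : ℕ) : n + 1 ≤ wtA n := by
  have : n + 1 < 2 ^ (n + 1) := Nat.lt_two_pow_self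
  unfold wtA
  omega

theorem finite_wtA_le (N : ℕ) : {m : Exponent | Finsupp.weight wtA m ≤ N}.Finite :=
  finite_weight_le wtA (fun i => by have := le_wtA i; omega)
    (fun N => (Set.finite_le_nat N).subset fun i (hi : wtA i ≤ N) => by
      have := le_wtA i
      show i ≤ N
      omega) N

/-- The mod 2 Steenrod algebra `A`, the graded dual of `A_*`, in its Milnor basis: the
coefficient of `Sq(R)`, the functional dual to `ξ^R`, is the value at `R`. -/
def SteenrodAlgebra := Exponent →₀ ZMod 2

instance : AddCommGroup SteenrodAlgebra := inferInstanceAs (AddCommGroup (Exponent →₀ ZMod 2))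

/-- The product of `A` is dual to the coproduct of `A_*`: `⟨ab, p⟩ = ⟨a ⊗ b, Δ p⟩`. -/
def mulA (a b : Exponent →₀ ZMod 2) : Exponent →₀ ZMod 2 :=
  Finsupp.ofSupportFinite (fun R => pair2 a b (coprodA (monomial R 1))) <| by
    obtain ⟨B, hB⟩ := pair2_bound wtA a b
    exact (finite_wtA_le B).subset fun R hR => hB _ _ (homogeneous_coprodA R) hR

instance : Mul SteenrodAlgebra := ⟨mulA⟩

/-- The Milnor basis element `Sq(R)`. -/
def Sq (R : Exponent) : SteenrodAlgebra := Finsupp.single R (1 : ZMod 2)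

/-- `P_t^s = Sq(2^s Δ_t)`. -/
def P (t s : ℕ) : SteenrodAlgebra := Sq (2 ^ s • expDelta t)

/-- The contraction by `ξ^S`, defined by `⟨cont(ξ^S, a), q⟩ = ⟨a, ξ^S q⟩`. -/
def cont (S : Exponent) (a : SteenrodAlgebra) : SteenrodAlgebra :=
  Finsupp.comapDomain (M := ZMod 2) (fun R : Exponent => S + R) a (add_right_injective S).injOn

/-- `κ(a) = cont(ξ₁, a)`. -/
def kappa (a : SteenrodAlgebra) : SteenrodAlgebra := cont (expDelta 1) a

/-- The largest `i` such that `ξ_i` occurs in a `ξ^R` for which `Sq(R)` occurs in `a`. -/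
def maxIndex (a : SteenrodAlgebra) : ℕ :=
  (Finsupp.support (M := ZMod 2) a).sup fun R => R.support.sup fun n => n + 1

/-- Contractions by multiples of `ξ_i` vanish for `i` above `maxIndex a`. -/
theorem cont_eq_zero (a : SteenrodAlgebra) (i : ℕ) (hi : maxIndex a < i) (S : Exponent)
    (hS : expDelta i ≤ S) : cont S a = 0 := by
  refine Finsupp.ext (M := ZMod 2) fun R => ?_
  change (show Exponent →₀ ZMod 2 from a) (S + R) = 0
  by_contra h
  obtain ⟨n, rfl⟩ : ∃ n, i = n + 1 := ⟨i - 1, by omega⟩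
  have h1 : 1 ≤ (S + R) n := by
    have := hS n
    simp only [expDelta, Finsupp.single_eq_same] at this
    simp only [Finsupp.add_apply]
    omega
  have h2 : n + 1 ≤ (S + R).support.sup fun n => n + 1 :=
    Finset.le_sup (f := fun n => n + 1) (Finsupp.mem_support_iff.2 (by omega))
  have h3 : ((S + R).support.sup fun n => n + 1) ≤ maxIndex a :=
    Finset.le_sup (f := fun R : Exponent => R.support.sup fun n => n + 1)
      (Finsupp.mem_support_iff.2 h)
  omega

theorem zero_mulA (a : SteenrodAlgebra) : (0 : SteenrodAlgebra) * a = 0 :=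
  Finsupp.ext (M := ZMod 2) fun R =>
    show pair2 (0 : Exponent →₀ ZMod 2) a (coprodA (monomial R 1)) = 0 from Finsupp.sum_zero_index

/-! ## The Hopf algebra `D₀` -/

/-- The pairs `k < l`. -/
abbrev Pair := {p : ℕ × ℕ // p.1 < p.2}

/-- The indices of the variables `ξ_{n+1}` (`Sum.inl n`) and `ξ_{k,l}`, `0 ≤ k < l`
(`Sum.inr (k, l)`). -/
abbrev Idx := ℕ ⊕ Pair

/-- The degrees of `ξ_{n+1}` and `ξ_{k,l}`. -/
def wtD : Idx → ℕ := Sum.elim wtA fun p => 2 ^ p.1.1 + 2 ^ p.1.2 - 1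

/-- `ξ_{n-k} ⊗ 1`. -/
def xiL (n k : ℕ) : MvPolynomial (Idx ⊕ Idx) (ZMod 4) :=
  xiSub (fun i => X (Sum.inl (Sum.inl i))) n k

/-- `1 ⊗ ξ_n`. -/
def xiR (n : ℕ) : MvPolynomial (Idx ⊕ Idx) (ZMod 4) :=
  xi (fun i => X (Sum.inr (Sum.inl i))) n

/-- `1 ⊗ ξ_{k,l}`. -/
def xiPairR (p : Pair) : MvPolynomial (Idx ⊕ Idx) (ZMod 4) := X (Sum.inr (Sum.inr p))

/-- The coproducts of `ξ_{n+1}` and `ξ_{n,m}` that express the composition modulo 4 of power series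
`∑_{k ≥ 0} ξ_k x^{2^k} + ∑_{0 ≤ k < l} 2 ξ_{k,l} x^{2^k + 2^l}`:
* `Δ ξ_n = ∑_{i+j=n} ξ_i^{2^j} ⊗ ξ_j + 2 ∑_{k<l} ξ_{n-1-k}^{2^k} ξ_{n-1-l}^{2^l} ⊗ ξ_{k,l}`,
* `Δ ξ_{n,m} = ξ_{n,m} ⊗ 1 + ∑_k ξ_{n-k}^{2^k} ξ_{m-k}^{2^k} ⊗ ξ_{k+1}
  + ∑_{k<l} (ξ_{n-k}^{2^k} ξ_{m-l}^{2^l} + ξ_{m-k}^{2^k} ξ_{n-l}^{2^l}) ⊗ ξ_{k,l}`. -/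
def coprodDGen : Idx → MvPolynomial (Idx ⊕ Idx) (ZMod 4)
  | Sum.inl n =>
      ∑ j ∈ Finset.range (n + 2), xiL (n + 1) j ^ 2 ^ j * xiR j
      + 2 * ∑ l ∈ Finset.range (n + 1), ∑ k : Fin l,
          xiL n k ^ 2 ^ (k : ℕ) * xiL n l ^ 2 ^ l * xiPairR ⟨(k, l), k.2⟩
  | Sum.inr p =>
      X (Sum.inl (Sum.inr p))
      + ∑ k ∈ Finset.range (p.1.1 + 1),
          xiL p.1.1 k ^ 2 ^ k * xiL p.1.2 k ^ 2 ^ k * xiR (k + 1)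
      + ∑ l ∈ Finset.range (p.1.2 + 1), ∑ k : Fin l,
          (xiL p.1.1 k ^ 2 ^ (k : ℕ) * xiL p.1.2 l ^ 2 ^ l
            + xiL p.1.2 k ^ 2 ^ (k : ℕ) * xiL p.1.1 l ^ 2 ^ l) * xiPairR ⟨(k, l), k.2⟩

/-- The coproduct on `ℤ/4[ξ_n, ξ_{k,l}]`; it is only used on the subring
`D_{0*} = ℤ/4[ξ_n, 2ξ_{k,l}]`. -/
def coprodD : MvPolynomial Idx (ZMod 4) →ₐ[ZMod 4] MvPolynomial (Idx ⊕ Idx) (ZMod 4) :=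
  aeval coprodDGen

theorem homogeneous_xiL_mul (n m k l : ℕ) (e : ℕ)
    (q : MvPolynomial (Idx ⊕ Idx) (ZMod 4))
    (hq : IsWeightedHomogeneous (Sum.elim wtD wtD) q e) (N : ℕ)
    (hN : k ≤ n → l ≤ m → 2 ^ n - 2 ^ k + (2 ^ m - 2 ^ l) + e = N) :
    IsWeightedHomogeneous (Sum.elim wtD wtD) (xiL n k ^ 2 ^ k * xiL m l ^ 2 ^ l * q) N := by
  by_cases h1 : k ≤ n
  · by_cases h2 : l ≤ m
    · rw [← hN h1 h2]
      exact ((homogeneous_xiSub _ (fun i => Sum.inl (Sum.inl i)) (fun _ => rfl) n k).mul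
        (homogeneous_xiSub _ (fun i => Sum.inl (Sum.inl i)) (fun _ => rfl) m l)).mul hq
    · have : xiL m l = 0 := if_neg h2
      rw [this, zero_pow (by positivity), mul_zero, zero_mul]
      exact isWeightedHomogeneous_zero _ _ _
  · have : xiL n k = 0 := if_neg h1
    rw [this, zero_pow (by positivity), zero_mul, zero_mul]
    exact isWeightedHomogeneous_zero _ _ _

theorem homogeneous_coprodDGen (i : Idx) :
    IsWeightedHomogeneous (Sum.elim wtD wtD) (coprodDGen i) (wtD i) := by
  have hR : ∀ n, IsWeightedHomogeneous (Sum.elim wtD wtD) (xiR n) (2 ^ n - 1) := fun n =>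
    homogeneous_xi _ (fun i => Sum.inr (Sum.inl i)) (fun _ => rfl) n
  have hP : ∀ p : Pair, IsWeightedHomogeneous (Sum.elim wtD wtD) (xiPairR p)
      (2 ^ p.1.1 + 2 ^ p.1.2 - 1) := fun p =>
    isWeightedHomogeneous_X (ZMod 4) (Sum.elim wtD wtD) (Sum.inr (Sum.inr p))
  have hpow : ∀ a b : ℕ, a ≤ b → 2 ^ a ≤ 2 ^ b := fun a b h =>
    Nat.pow_le_pow_right (by norm_num) h
  have hone : ∀ a : ℕ, 1 ≤ 2 ^ a := fun a => Nat.one_le_two_pow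
  rcases i with n | ⟨⟨n, m⟩, hnm⟩
  · refine IsWeightedHomogeneous.add ?_ ?_
    · refine IsWeightedHomogeneous.sum _ _ _ fun j hj => ?_
      have h1 := homogeneous_xiSub (k := ZMod 4) (Sum.elim wtD wtD) (fun i => Sum.inl (Sum.inl i))
        (fun _ => rfl) (n + 1) j
      have h3 := hpow j (n + 1) (Nat.lt_succ_iff.1 (Finset.mem_range.1 hj))
      have h4 := hone j
      have h5 : 2 ^ (n + 1) - 1 = 2 ^ (n + 1) - 2 ^ j + (2 ^ j - 1) := by omega
      change IsWeightedHomogeneous _ _ (2 ^ (n + 1) - 1)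
      rw [h5]
      exact h1.mul (hR j)
    · have h2 : (2 : MvPolynomial (Idx ⊕ Idx) (ZMod 4)) = C 2 := (map_ofNat C 2).symm
      rw [h2]
      refine IsWeightedHomogeneous.C_mul ?_ _
      refine IsWeightedHomogeneous.sum _ _ _ fun l _ => ?_
      refine IsWeightedHomogeneous.sum _ _ _ fun k _ => ?_
      refine homogeneous_xiL_mul _ _ _ _ _ _ (hP _) _ fun h1 h2 => ?_
      have h3 := hpow _ _ h1
      have h4 := hpow _ _ h2
      have h5 := hone k
      have h6 := hone l
      have h7 : 2 ^ (n + 1) = 2 * 2 ^ n := by ring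
      change _ = 2 ^ (n + 1) - 1
      dsimp only
      omega
  · refine IsWeightedHomogeneous.add (IsWeightedHomogeneous.add ?_ ?_) ?_
    · exact isWeightedHomogeneous_X (ZMod 4) (Sum.elim wtD wtD) _
    · refine IsWeightedHomogeneous.sum _ _ _ fun k _ => ?_
      refine homogeneous_xiL_mul _ _ _ _ _ _ (hR _) _ fun h1 h2 => ?_
      have h3 := hpow _ _ h1
      have h4 := hpow _ _ h2
      have h5 := hone k
      have h7 : 2 ^ (k + 1) = 2 * 2 ^ k := by ring
      change _ = 2 ^ n + 2 ^ m - 1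
      dsimp only at *
      omega
    · refine IsWeightedHomogeneous.sum _ _ _ fun l _ => ?_
      refine IsWeightedHomogeneous.sum _ _ _ fun k _ => ?_
      have h5 := hone k
      have h6 := hone l
      rw [add_mul]
      refine IsWeightedHomogeneous.add ?_ ?_
      all_goals
        refine homogeneous_xiL_mul _ _ _ _ _ _ (hP _) _ fun h1 h2 => ?_
        have h3 := hpow _ _ h1
        have h4 := hpow _ _ h2
        change _ = 2 ^ n + 2 ^ m - 1
        dsimp only at *
        omega

theorem homogeneous_coprodD (m : Idx →₀ ℕ) :
    IsWeightedHomogeneous (Sum.elim wtD wtD) (coprodD (monomial m 1)) (Finsupp.weight wtD m) :=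
  homogeneous_aeval _ _ _ homogeneous_coprodDGen m

theorem le_wtD_pair (p : Pair) : p.1.1 + p.1.2 + 1 ≤ wtD (Sum.inr p) := by
  have h1 : p.1.1 + 1 ≤ 2 ^ p.1.1 := Nat.lt_two_pow_self
  have h2 : p.1.2 + 1 ≤ 2 ^ p.1.2 := Nat.lt_two_pow_self
  simp only [wtD, Sum.elim_inr]
  omega

theorem finite_wtD_le (N : ℕ) : {m : Idx →₀ ℕ | Finsupp.weight wtD m ≤ N}.Finite := by
  refine finite_weight_le wtD ?_ ?_ N
  · rintro (n | p)
    · have := le_wtA n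
      simp only [wtD, Sum.elim_inl]
      omega
    · have := le_wtD_pair p
      omega
  · intro N
    have h1 : {n : ℕ | n ≤ N}.Finite := Set.finite_le_nat N
    have h2 : {p : Pair | p.1 ∈ {n : ℕ | n ≤ N} ×ˢ {n : ℕ | n ≤ N}}.Finite :=
      (h1.prod h1).preimage Subtype.val_injective.injOn
    refine ((h1.image Sum.inl).union (h2.image Sum.inr)).subset ?_
    rintro (n | p) hi
    · refine Or.inl ⟨n, ?_, rfl⟩
      have := le_wtA n
      change wtA n ≤ N at hi
      show n ≤ N
      omega
    · refine Or.inr ⟨p, ?_, rfl⟩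
      have := le_wtD_pair p
      change wtD (Sum.inr p) ≤ N at hi
      show p.1.1 ≤ N ∧ p.1.2 ≤ N
      omega

/-- `D₀`, the graded dual of `D_{0*} = ℤ/4[ξ_n, 2ξ_{k,l}]`, in the form
`ℤ/4{Sq(R)} ⊕ ∑_{k<l} Y_{k-1,l-1} A`. Here `Y_{k-1,l-1} Sq(R)` is the functional with value `2` on
`2 ξ_{k,l} ξ^R` and `0` on the other elements of the basis `{ξ^S, 2 ξ_{m,n} ξ^S}`, and `Sq(R)` is the
one with value `1` on `ξ^R` and `0` on the others. -/
def D0 := (Exponent →₀ ZMod 4) × (Pair →₀ SteenrodAlgebra)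

instance : AddCommGroup D0 :=
  inferInstanceAs (AddCommGroup ((Exponent →₀ ZMod 4) × (Pair →₀ SteenrodAlgebra)))

/-- The lift `ℤ/2 → ℤ/4`, `0 ↦ 0`, `1 ↦ 1`. -/
def lift (z : ZMod 2) : ZMod 4 := (z.val : ZMod 4)

/-- The exponent of `ξ^R` among the monomials of `ℤ/4[ξ_n, ξ_{k,l}]`. -/
def monoXi (R : Exponent) : Idx →₀ ℕ := R.mapDomain Sum.inl

/-- The exponent of `ξ_{k,l} ξ^R` among the monomials of `ℤ/4[ξ_n, ξ_{k,l}]`. -/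
def monoXiPair (p : Pair) (R : Exponent) : Idx →₀ ℕ := Finsupp.single (Sum.inr p) 1 + monoXi R

/-- The extension of a functional `d ∈ D₀` to `ℤ/4[ξ_n, ξ_{k,l}]`, as a linear combination of the
functionals dual to monomials. (The functional that is dual to the monomial `ξ_{k,l} ξ^R` restricts
to `Y_{k-1,l-1} Sq(R)` on `D_{0*}`.) -/
def D0.toDual (d : D0) : (Idx →₀ ℕ) →₀ ZMod 4 :=
  d.1.mapDomain monoXi +
    d.2.sum fun p a => Finsupp.sum (M := ZMod 2) a fun R z =>
      Finsupp.single (monoXiPair p R) (lift z)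

theorem monoXi_injective : Function.Injective monoXi :=
  Finsupp.mapDomain_injective Sum.inl_injective

theorem monoXi_inr (R : Exponent) (p : Pair) : monoXi R (Sum.inr p) = 0 :=
  Finsupp.mapDomain_of_notMem_range _ _ (by simp)

theorem monoXiPair_injective : Function.Injective fun q : Pair × Exponent => monoXiPair q.1 q.2 := by
  rintro ⟨p, R⟩ ⟨p', R'⟩ h
  have h1 : p = p' := by
    have h2 := DFunLike.congr_fun h (Sum.inr p)
    by_contra hne
    have h3 : (Sum.inr p' : Idx) ≠ Sum.inr p := fun h => hne (Sum.inr_injective h).symm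
    simp [monoXiPair, monoXi_inr, h3] at h2
  subst h1
  have h2 : monoXi R = monoXi R' := add_left_cancel h
  rw [monoXi_injective h2]

/-- The product of `D₀` is dual to the coproduct of `D_{0*}`: `⟨de, p⟩ = ⟨d ⊗ e, Δ p⟩` for
`p = ξ^R`, which gives the coefficient of `Sq(R)`, and for `p = 2 ξ_{k,l} ξ^R`, which gives twice the
coefficient of `Y_{k-1,l-1} Sq(R)`. -/
def mulD0 (d e : D0) : D0 :=
  (Finsupp.ofSupportFinite
      (fun R => pair2 d.toDual e.toDual (coprodD (monomial (monoXi R) 1))) <| by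
    obtain ⟨B, hB⟩ := pair2_bound wtD d.toDual e.toDual
    exact ((finite_wtD_le B).preimage monoXi_injective.injOn).subset
      fun R hR => hB _ _ (homogeneous_coprodD _) hR,
   Finsupp.curry (Finsupp.ofSupportFinite
      (fun q : Pair × Exponent => ZMod.castHom (show 2 ∣ 4 by norm_num) (ZMod 2)
        (pair2 d.toDual e.toDual (coprodD (monomial (monoXiPair q.1 q.2) 1)))) <| by
    obtain ⟨B, hB⟩ := pair2_bound wtD d.toDual e.toDual
    exact ((finite_wtD_le B).preimage monoXiPair_injective.injOn).subset
      fun q hq => hB _ _ (homogeneous_coprodD _) fun h => hq (by simp only [h, map_zero])))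

instance : Mul D0 := ⟨mulD0⟩

/-- The projection `π : D₀ → A` with `Sq(R) ↦ Sq(R)`, `Y_{k,l} a ↦ 0`. -/
def proj : D0 →+ SteenrodAlgebra where
  toFun d := Finsupp.mapRange (ZMod.castHom (show 2 ∣ 4 by norm_num) (ZMod 2)) (map_zero _) d.1
  map_zero' := Finsupp.mapRange_zero
  map_add' d e := Finsupp.mapRange_add (fun _ _ => map_add _ _ _) d.1 e.1

theorem proj_apply (d : D0) (R : Exponent) :
    (show Exponent →₀ ZMod 2 from proj d) R =
      ZMod.castHom (show 2 ∣ 4 by norm_num) (ZMod 2) (d.1 R) := rfl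

theorem pair2_add_left {σ k : Type*} [CommRing k] (x x' y : (σ →₀ ℕ) →₀ k)
    (q : MvPolynomial (σ ⊕ σ) k) : pair2 (x + x') y q = pair2 x y q + pair2 x' y q := by
  classical
  refine Finsupp.sum_add_index' (fun m => ?_) fun m a b => ?_
  · simp
  · rw [← Finsupp.sum_add]
    exact Finsupp.sum_congr fun n _ => by ring

theorem pair2_add_right {σ k : Type*} [CommRing k] (x y y' : (σ →₀ ℕ) →₀ k)
    (q : MvPolynomial (σ ⊕ σ) k) : pair2 x (y + y') q = pair2 x y q + pair2 x y' q := by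
  classical
  unfold pair2
  rw [← Finsupp.sum_add]
  refine Finsupp.sum_congr fun m _ => Finsupp.sum_add_index' (fun n => ?_) fun n a b => ?_
  · simp
  · ring

theorem pair2_eq_zero {σ k : Type*} [CommRing k] (x y : (σ →₀ ℕ) →₀ k)
    (q : MvPolynomial (σ ⊕ σ) k)
    (h : ∀ m ∈ x.support, ∀ n ∈ y.support, coeff (m.sumElim n) q = 0) : pair2 x y q = 0 :=
  Finset.sum_eq_zero fun m hm => Finset.sum_eq_zero fun n hn => by
    simp only [h m hm n hn, mul_zero]

theorem map_pair2 {σ k k' : Type*} [CommRing k] [CommRing k'] (φ : k →+* k')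
    (x y : (σ →₀ ℕ) →₀ k) (q : MvPolynomial (σ ⊕ σ) k) :
    φ (pair2 x y q) = pair2 (x.mapRange φ (map_zero φ)) (y.mapRange φ (map_zero φ))
      (MvPolynomial.map φ q) := by
  unfold pair2
  rw [Finsupp.sum_mapRange_index (fun m => by simp)]
  rw [map_finsuppSum]
  refine Finsupp.sum_congr fun m _ => ?_
  rw [Finsupp.sum_mapRange_index (fun m => by simp), map_finsuppSum]
  refine Finsupp.sum_congr fun n _ => ?_
  rw [map_mul, map_mul, coeff_map]

theorem monoXi_sumElim (R S : Exponent) :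
    (monoXi R).sumElim (monoXi S) = (R.sumElim S).mapDomain (Sum.map Sum.inl Sum.inl) := by
  rw [Finsupp.sumElim_eq_add, Finsupp.sumElim_eq_add, Finsupp.mapDomain_add, monoXi, monoXi,
    ← Finsupp.mapDomain_comp, ← Finsupp.mapDomain_comp, ← Finsupp.mapDomain_comp,
    ← Finsupp.mapDomain_comp]
  rfl

theorem coeff_rename_sumElim (m n : Idx →₀ ℕ) (q : MvPolynomial (ℕ ⊕ ℕ) (ZMod 2))
    (h : (∃ p, m (Sum.inr p) ≠ 0) ∨ ∃ p, n (Sum.inr p) ≠ 0) :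
    coeff (m.sumElim n) (rename (Sum.map Sum.inl Sum.inl : ℕ ⊕ ℕ → Idx ⊕ Idx) q) = 0 := by
  refine coeff_rename_eq_zero _ _ _ fun u hu => ?_
  exfalso
  rcases h with ⟨p, hp⟩ | ⟨p, hp⟩
  · apply hp
    have := DFunLike.congr_fun hu (Sum.inl (Sum.inr p))
    rw [Finsupp.mapDomain_of_notMem_range _ _ (by simp)] at this
    exact this.symm
  · apply hp
    have := DFunLike.congr_fun hu (Sum.inr (Sum.inr p))
    rw [Finsupp.mapDomain_of_notMem_range _ _ (by simp)] at this
    exact this.symm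

/-- The part of `d.toDual` that comes from the `Y_{k,l}`. -/
def D0.yDual (d : D0) : (Idx →₀ ℕ) →₀ ZMod 4 :=
  d.2.sum fun p a => Finsupp.sum (M := ZMod 2) a fun R z =>
    Finsupp.single (monoXiPair p R) (lift z)

theorem D0.yDual_support (d : D0) (m : Idx →₀ ℕ) (hm : d.yDual m ≠ 0) :
    ∃ p, m (Sum.inr p) ≠ 0 := by
  classical
  unfold D0.yDual at hm
  rw [Finsupp.sum, Finsupp.finsetSum_apply] at hm
  obtain ⟨p, _, h1⟩ := Finset.exists_ne_zero_of_sum_ne_zero hm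
  change (∑ R ∈ Finsupp.support (M := ZMod 2) (d.2 p),
    Finsupp.single (monoXiPair p R) (lift ((show Exponent →₀ ZMod 2 from d.2 p) R))) m ≠ 0 at h1
  rw [Finsupp.finsetSum_apply] at h1
  obtain ⟨R, _, h2⟩ := Finset.exists_ne_zero_of_sum_ne_zero h1
  refine ⟨p, ?_⟩
  have h3 : monoXiPair p R = m := by
    by_contra h
    exact h2 (Finsupp.single_eq_of_ne (Ne.symm h))
  rw [← h3]
  simp [monoXiPair]

theorem map_xiSub (φ : MvPolynomial (Idx ⊕ Idx) (ZMod 4) →+* MvPolynomial (Idx ⊕ Idx) (ZMod 2))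
    (v : ℕ → MvPolynomial (Idx ⊕ Idx) (ZMod 4)) (n k : ℕ) :
    φ (xiSub v n k) = xiSub (fun i => φ (v i)) n k := by
  unfold xiSub
  split_ifs
  · cases n - k <;> simp [xi]
  · simp

theorem map_coprodD (R : Exponent) :
    MvPolynomial.map (ZMod.castHom (show 2 ∣ 4 by norm_num) (ZMod 2))
        (coprodD (monomial (monoXi R) 1)) =
      rename (Sum.map Sum.inl Sum.inl) (coprodA (monomial R 1)) := by
  have h2 : (2 : MvPolynomial (Idx ⊕ Idx) (ZMod 2)) = 0 := CharP.cast_eq_zero _ 2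
  have hgen : ∀ n, MvPolynomial.map (ZMod.castHom (show 2 ∣ 4 by norm_num) (ZMod 2))
      (coprodDGen (Sum.inl n)) = rename (Sum.map Sum.inl Sum.inl) (coprodA (X n)) := by
    intro n
    simp only [coprodDGen, coprodA, map_add, map_mul, map_ofNat, h2, zero_mul, add_zero, aeval_X,
      map_sum, map_pow]
    refine Finset.sum_congr rfl fun j _ => ?_
    congr 1
    · congr 1
      unfold xiL xiSub
      split_ifs
      · cases n + 1 - j <;> simp [xi]
      · simp
    · unfold xiR
      cases j <;> simp [xi]
  have e1 : (monomial (monoXi R) (1 : ZMod 4)) = R.prod fun n c => (X (Sum.inl n)) ^ c := by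
    rw [monomial_eq, C_1, one_mul, monoXi, Finsupp.prod_mapDomain_index_inj Sum.inl_injective]
  have e2 : (monomial R (1 : ZMod 2)) = R.prod fun n c => (X n) ^ c := by
    rw [monomial_eq, C_1, one_mul]
  rw [e1, e2]
  unfold Finsupp.prod
  simp only [map_prod, map_pow]
  refine Finset.prod_congr rfl fun n _ => ?_
  rw [← hgen n, coprodD, aeval_X]

/-- The projection `π` is multiplicative. -/
theorem proj_mul (d e : D0) : proj (d * e) = proj d * proj e := by
  refine Finsupp.ext (M := ZMod 2) fun R => ?_
  change ZMod.castHom (show 2 ∣ 4 by norm_num) (ZMod 2)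
      (pair2 d.toDual e.toDual (coprodD (monomial (monoXi R) 1))) =
    pair2 (show Exponent →₀ ZMod 2 from proj d) (show Exponent →₀ ZMod 2 from proj e)
      (coprodA (monomial R 1))
  rw [map_pair2, map_coprodD]
  have hd : ∀ d : D0, d.toDual.mapRange (ZMod.castHom (show 2 ∣ 4 by norm_num) (ZMod 2))
      (map_zero _) = (show Exponent →₀ ZMod 2 from proj d).mapDomain monoXi +
        d.yDual.mapRange (ZMod.castHom (show 2 ∣ 4 by norm_num) (ZMod 2)) (map_zero _) := by
    intro d
    have : d.toDual = d.1.mapDomain monoXi + d.yDual := rfl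
    rw [this, Finsupp.mapRange_add (fun _ _ => map_add _ _ _)]
    congr 1
    exact (Finsupp.mapDomain_mapRange _ _ _ _ fun _ _ => map_add _ _ _).symm
  have hy : ∀ d : D0, ∀ m ∈ (d.yDual.mapRange (ZMod.castHom (show 2 ∣ 4 by norm_num) (ZMod 2))
      (map_zero _)).support, ∃ p, m (Sum.inr p) ≠ 0 := by
    intro d m hm
    refine d.yDual_support m fun h => ?_
    rw [Finsupp.mem_support_iff, Finsupp.mapRange_apply, h, map_zero] at hm
    exact hm rfl
  rw [hd d, hd e, pair2_add_left, pair2_add_right, pair2_eq_zero _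
    (e.yDual.mapRange (ZMod.castHom (show 2 ∣ 4 by norm_num) (ZMod 2)) (map_zero _)),
    pair2_eq_zero (d.yDual.mapRange (ZMod.castHom (show 2 ∣ 4 by norm_num) (ZMod 2)) (map_zero _)),
    add_zero, add_zero]
  · unfold pair2
    rw [Finsupp.sum_mapDomain_index_inj monoXi_injective]
    refine Finsupp.sum_congr fun m _ => ?_
    rw [Finsupp.sum_mapDomain_index_inj monoXi_injective]
    refine Finsupp.sum_congr fun n _ => ?_
    rw [monoXi_sumElim, coeff_rename_mapDomain _
      (Function.Injective.sumMap Sum.inl_injective Sum.inl_injective)]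
  · exact fun m hm n _ => coeff_rename_sumElim _ _ _ (Or.inl (hy d m hm))
  · exact fun m _ n hn => coeff_rename_sumElim _ _ _ (Or.inr (hy e n hn))

/-- `R_D = ker π`. -/
abbrev RD : AddSubgroup D0 := proj.ker

/-! ## The bimodule `D₁` -/

/-- `D₁ = A ⊕ μ₀ A ⊕ ∑_{-1 ≤ k < l} U_{k,l} A`. This is the quotient of
`A ⊕ μ₀ A ⊕ ∑_{-1 ≤ k, 0 ≤ l} U_{k,l} A` by the relations which express `U_{k,l}` with `l ≤ k` in
terms of the other generators (see `D1.U`). The coefficient of `U_{k-1,l-1}`, `0 ≤ k < l`, is stored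
at the pair `(k, l)`. -/
def D1 := SteenrodAlgebra × SteenrodAlgebra × (Pair →₀ SteenrodAlgebra)

instance : AddCommGroup D1 :=
  inferInstanceAs (AddCommGroup (SteenrodAlgebra × SteenrodAlgebra × (Pair →₀ SteenrodAlgebra)))

/-- The inclusion `A → D₁`. -/
def D1.incl (a : SteenrodAlgebra) : D1 := (a, 0, 0)

/-- The element `μ₀ a`. -/
def D1.mu (a : SteenrodAlgebra) : D1 := (0, a, 0)

/-- The element `U_{m-1,n-1} a` for `0 ≤ m`, `1 ≤ n`. With `k = m - 1`, `l = n - 1`: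
`U_{k,l} = U_{l,k} + Sq(Δ_{k+1} + Δ_{l+1})` for `l < k` and
`U_{k,k} = μ₀ Sq(Δ_{k+2}) + Sq(2Δ_{k+1})`. -/
def D1.U (m n : ℕ) (a : SteenrodAlgebra) : D1 :=
  if h : m < n then (0, 0, Finsupp.single ⟨(m, n), h⟩ a)
  else if h : n < m then
    (Sq (expDelta m + expDelta n) * a, 0, Finsupp.single ⟨(n, m), h⟩ a)
  else (Sq (2 • expDelta m) * a, Sq (expDelta (m + 1)) * a, 0)

/-- The right action of `A` on `D₁`. -/
def D1.rmul (x : D1) (a : SteenrodAlgebra) : D1 :=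
  (x.1 * a, x.2.1 * a, x.2.2.mapRange (fun b => b * a) (zero_mulA a))

/-- The left action of `A` on `D₁`: `a μ₀ = μ₀ a + κ(a)` and
`a U_{k,l} = ∑_{i,j ≥ 0} U_{k+i,l+j} cont(ξ_i^{2^{k+1}} ξ_j^{2^{l+1}}, a)`. -/
def D1.lmul (a : SteenrodAlgebra) (x : D1) : D1 :=
  D1.incl (a * x.1) + (D1.mu (a * x.2.1) + D1.incl (kappa a * x.2.1)) +
    x.2.2.sum fun p b =>
      ∑ i ∈ Finset.range (maxIndex a + 1), ∑ j ∈ Finset.range (maxIndex a + 1),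
        D1.U (p.1.1 + i) (p.1.2 + j)
          (cont (2 ^ p.1.1 • expDelta i + 2 ^ p.1.2 • expDelta j) a * b)

/-- `∂ : D₁ → D₀` with `∂ a = 0`, `∂ (μ₀ a) = 2a`, `∂ (U_{k,l} a) = Y_{k,l} a`. -/
def D1.bdry (x : D1) : D0 :=
  (Finsupp.mapRange (fun z : ZMod 2 => 2 * lift z) (by decide) x.2.1, x.2.2)

/-! ## Massey products -/

/-- A choice of sections `σ : A → D₀` of `π` and `u : R_D → D₁` of `∂`. -/
structure Sections where
  σ : SteenrodAlgebra → D0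
  σ_zero : σ 0 = 0
  proj_σ : ∀ a, proj (σ a) = a
  u : RD →+ D1
  bdry_u : ∀ r : RD, (u r).bdry = r

/-- `τ(a, b) = u(σ(ab) - σ(a)σ(b))`. -/
def Sections.tau (S : Sections) (a b : SteenrodAlgebra) : D1 :=
  S.u ⟨S.σ (a * b) - S.σ a * S.σ b, by
    rw [AddMonoidHom.mem_ker, map_sub, proj_mul, S.proj_σ, S.proj_σ, S.proj_σ, sub_self]⟩

/-- `⟨a, b, c⟩ = τ(ab, c) - τ(a, b)σ(c) - τ(a, bc) + σ(a)τ(b, c)`, computed with given sections.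
Here `D₀` acts on `D₁` through `π`. -/
def Sections.bracket (S : Sections) (a b c : SteenrodAlgebra) : D1 :=
  S.tau (a * b) c - (S.tau a b).rmul (proj (S.σ c)) - S.tau a (b * c)
    + D1.lmul (proj (S.σ a)) (S.tau b c)

/-- The set of values in `A` of the Massey product `⟨a, b, c⟩`, for all choices of sections. -/
def massey (a b c : SteenrodAlgebra) : Set SteenrodAlgebra :=
  {x | ∃ S : Sections, S.bracket a b c = D1.incl x}

/-- The map `ℤ/4 → ℤ/2` with `2z ↦ z` on even elements. -/
def half (z : ZMod 4) : ZMod 2 := ((z.val / 2 : ℕ) : ZMod 2)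

theorem half_zero : half 0 = 0 := by decide

theorem lift_zero : lift 0 = 0 := by decide

theorem half_add : ∀ z w : ZMod 4, ZMod.castHom (show 2 ∣ 4 by norm_num) (ZMod 2) z = 0 →
    ZMod.castHom (show 2 ∣ 4 by norm_num) (ZMod 2) w = 0 → half (z + w) = half z + half w := by
  decide

theorem two_mul_lift_half : ∀ z : ZMod 4,
    ZMod.castHom (show 2 ∣ 4 by norm_num) (ZMod 2) z = 0 → 2 * lift (half z) = z := by
  decide

theorem cast_lift : ∀ z : ZMod 2,
    ZMod.castHom (show 2 ∣ 4 by norm_num) (ZMod 2) (lift z) = z := by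
  decide

theorem RD.cast_eq_zero (r : RD) (R : Exponent) :
    ZMod.castHom (show 2 ∣ 4 by norm_num) (ZMod 2) (r.1.1 R) = 0 := by
  rw [← proj_apply, (AddMonoidHom.mem_ker).1 r.2]
  rfl

/-- The sections `σ(∑ c_i Sq(R_i)) = ∑ ĉ_i Sq(R_i)`, with `ĉ` the lift of `c` to `{0, 1} ⊆ ℤ/4`, and
`u(2 Sq(R)) = μ₀ Sq(R)`, `u(Y_{k,l} Sq(R)) = U_{k,l} Sq(R)` for `k < l`. -/
def standardSections : Sections where
  σ a := (Finsupp.mapRange (M := ZMod 2) lift lift_zero a, 0)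
  σ_zero := Prod.ext (Finsupp.mapRange_zero (hf := lift_zero)) rfl
  proj_σ _ := Finsupp.ext (M := ZMod 2) fun _ => cast_lift _
  u :=
    { toFun := fun r => (0, Finsupp.mapRange half half_zero r.1.1, r.1.2)
      map_zero' := Prod.ext rfl (Prod.ext (Finsupp.mapRange_zero (hf := half_zero)) rfl)
      map_add' := fun r s => Prod.ext (add_zero _).symm <| Prod.ext
        (Finsupp.ext (M := ZMod 2) fun R =>
          half_add _ _ (RD.cast_eq_zero r R) (RD.cast_eq_zero s R)) rfl }
  bdry_u r := Prod.ext (x := (_ : D0)) (y := (r : D0))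
    (Finsupp.ext (M := ZMod 4) fun R => two_mul_lift_half _ (RD.cast_eq_zero r R)) rfl

end

end SecondarySteenrod

open SecondarySteenrod (P Sq massey standardSections expDelta D1.incl)

/-!
The class `a = P_t^s` squares to zero for `s < t`, so its bracket with the standard sections is
`τ(a, a) a + a τ(a, a)`, where `τ(a, a) = u(-σ(a)²)`. The product of `Sq(cΔ_p)` and `Sq(dΔ_q)`, in
`A` or in `D_0`, only involves the coefficients of `ξ_p ^ c ⊗ ξ_q ^ d` in coproducts, and these
survive when all variables but `ξ_p ⊗ 1` and `1 ⊗ ξ_q` are killed. Then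
`Δ ξ_n = [n = p] x + [n = q] y + [n = p + q] x ^ 2 ^ q * y` and
`Δ (2 ξ_{k,l}) = [(k, l) = (q - 1, p + q - 1)] 2 x ^ 2 ^ (q - 1) * y`, so that
`σ(a)² = 2 Sq(2 ^ (s + 1) Δ_t) + [s = t - 1] Y_{t-2,2t-2} b` with `b = Sq((2 ^ (t - 1) - 1) Δ_t)`.

For `s < t - 1` this gives `τ(a, a) = μ₀ Sq(2 ^ (s + 1) Δ_t)`, and the bracket vanishes because `a`
commutes with `Sq(2 ^ (s + 1) Δ_t)` and `cont(ξ_1, a) = 0`. For `s = t - 1`, moving `a` past `μ₀`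
and `U_{t-2,2t-2}` produces the extra terms `cont(ξ_1, a) Sq(2 ^ t Δ_t)` and
`U_{2t-2,2t-2} b = μ₀ Sq(Δ_{2t}) b + Sq(2 Δ_{2t-1}) b`. The commutator of `a` and `Sq(2 ^ t Δ_t)` is
`Sq(Δ_{2t}) b`, so the `μ₀`-parts cancel and the bracket is
`cont(ξ_1, a) Sq(2 ^ t Δ_t) + Sq(2 Δ_{2t-1}) b`. The first term vanishes for `t ≥ 2`, while for
`t = 1` both terms are `Sq(2 Δ_1)`.
-/

namespace SecondarySteenrod

open Polynomial (C X)
open scoped Polynomial Polynomial.Bivariate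

noncomputable section

section Restriction

variable {k : Type*} [CommRing k]

theorem coeff_coeff_CX_pow_mul_Y_pow_mul (i j c d : ℕ) (f : k[X][Y]) :
    ((C X ^ i * Y ^ j * f).coeff d).coeff c =
      if i ≤ c ∧ j ≤ d then (f.coeff (d - j)).coeff (c - i) else 0 := by
  rw [mul_assoc, ← C.map_pow, Polynomial.coeff_C_mul, Polynomial.coeff_X_pow_mul',
    Polynomial.coeff_X_pow_mul']
  split_ifs with hj hi <;> simp_all

theorem coeff_coeff_CX_pow_mul_Y_pow (i j c d : ℕ) :
    ((C X ^ i * Y ^ j : k[X][Y]).coeff d).coeff c = if i = c ∧ j = d then 1 else 0 := by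
  rw [← C.map_pow, Polynomial.coeff_C_mul, Polynomial.coeff_X_pow]
  split_ifs with hd h h <;> simp_all [Polynomial.coeff_X_pow, eq_comm]

theorem coeff_coeff_CX_add_Y_pow (r c d : ℕ) :
    (((C X + Y : k[X][Y]) ^ r).coeff d).coeff c = if c + d = r then (r.choose c : k) else 0 := by
  rw [add_comm, Polynomial.coeff_X_add_C_pow, ← Polynomial.C_eq_natCast, Polynomial.coeff_mul_C,
    Polynomial.coeff_X_pow]
  split_ifs with h h' h'
  · subst h'
    rw [one_mul, Nat.choose_symm_add]
  · rw [Nat.choose_eq_zero_of_lt (by omega)]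
    simp
  · omega
  · simp

theorem add_single_eq_iff {ι : Type*} {a : ι} {m m' : ι →₀ ℕ} (hm : m a = 0) (e : ℕ) :
    m + Finsupp.single a e = m' ↔ e = m' a ∧ m = m'.erase a := by
  constructor
  · rintro rfl
    simp [hm, Finsupp.erase_add]
  · rintro ⟨rfl, rfl⟩
    exact Finsupp.erase_add_single a m'

theorem prod_pow_eq_pow_mul_prod_erase {ι M : Type*} [CommMonoid M] {g g' : ι → M} {a : ι}
    (h : ∀ i ≠ a, g i = g' i) (m : ι →₀ ℕ) :
    (m.prod fun i e => g i ^ e) = g a ^ m a * (m.erase a).prod fun i e => g' i ^ e := by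
  rw [← Finsupp.mul_prod_erase' m a _ fun i => pow_zero (g i)]
  congr 1
  refine Finsupp.prod_congr fun i hi => ?_
  rw [h i]
  rintro rfl
  simp at hi

theorem prod_piSingle_pow {ι M : Type*} [DecidableEq ι] [CommMonoidWithZero M] (a : ι) (x : M)
    (m : ι →₀ ℕ) :
    (m.prod fun i e => (Pi.single a x : ι → M) i ^ e) =
      if m = Finsupp.single a (m a) then x ^ m a else 0 := by
  split_ifs with h
  · rw [h]
    simp [Finsupp.prod_single_index]
  · rw [← Finsupp.support_subset_singleton, Finset.not_subset] at h
    obtain ⟨i, hi, hia⟩ := h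
    refine Finset.prod_eq_zero hi ?_
    dsimp only
    rw [Pi.single_eq_of_ne (by simpa using hia), zero_pow (Finsupp.mem_support_iff.1 hi)]

/-- The substitution on `k[σ] ⊗ k[σ]` that keeps one variable of each tensor factor, the variable
`a` on the left as `x` and the variable `b` on the right as `y`, and kills the others. It reads off
the coefficients of the monomials `ξ_a ^ c ⊗ ξ_b ^ d`. -/
def restrict {σ : Type*} [DecidableEq σ] (k : Type*) [CommRing k] (a b : σ) :
    MvPolynomial (σ ⊕ σ) k →ₐ[k] k[X][Y] :=
  MvPolynomial.aeval (Sum.elim (Pi.single a (C X)) (Pi.single b Y))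

theorem restrict_monomial_sumElim {σ : Type*} [DecidableEq σ] (a b : σ) (m n : σ →₀ ℕ) (z : k) :
    restrict k a b (MvPolynomial.monomial (m.sumElim n) z) =
      if m = Finsupp.single a (m a) ∧ n = Finsupp.single b (n b) then
        C (C z) * (C X ^ m a * Y ^ n b) else 0 := by
  rw [restrict, MvPolynomial.aeval_monomial, Finsupp.prod_sumElim]
  simp only [Function.comp_def, Sum.elim_inl, Sum.elim_inr, prod_piSingle_pow]
  rw [ite_zero_mul_ite_zero, mul_ite, mul_zero]
  rfl

theorem coeff_coeff_restrict {σ : Type*} [DecidableEq σ] (a b : σ) (c d : ℕ)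
    (f : MvPolynomial (σ ⊕ σ) k) :
    ((restrict k a b f).coeff d).coeff c =
      f.coeff ((Finsupp.single a c).sumElim (Finsupp.single b d)) := by
  induction f using MvPolynomial.induction_on' with
  | add f g hf hg => simp only [map_add, Polynomial.coeff_add, hf, hg, MvPolynomial.coeff_add]
  | monomial u z =>
    obtain ⟨⟨m, n⟩, rfl⟩ := Finsupp.sumFinsuppEquivProdFinsupp.symm.surjective u
    change ((restrict k a b (MvPolynomial.monomial (m.sumElim n) z)).coeff d).coeff c =
      (MvPolynomial.monomial (m.sumElim n) z).coeff _
    have hmn : m.sumElim n = (Finsupp.single a c).sumElim (Finsupp.single b d) ↔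
        m = Finsupp.single a c ∧ n = Finsupp.single b d :=
      Finsupp.sumFinsuppEquivProdFinsupp.symm.injective.eq_iff (a := (m, n)).trans Prod.mk_inj
    simp only [restrict_monomial_sumElim, MvPolynomial.coeff_monomial, hmn]
    by_cases h : m = Finsupp.single a (m a) ∧ n = Finsupp.single b (n b)
    · rw [if_pos h, Polynomial.coeff_C_mul, Polynomial.coeff_C_mul, coeff_coeff_CX_pow_mul_Y_pow,
        mul_ite, mul_one, mul_zero]
      refine if_congr ?_ rfl rfl
      rw [h.1, h.2, Finsupp.single_eq_same, Finsupp.single_eq_same]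
      simp only [(Finsupp.single_injective _).eq_iff]
    · rw [if_neg h, if_neg fun h' => h (by simp [h'.1, h'.2])]
      simp

/-- The multinomial coefficient of the term `Sq(cΔ_{p+1} + dΔ_{q+1})` in Milnor's formula for the
product of `Sq(cΔ_{p+1})` and `Sq(dΔ_{q+1})`. -/
def leadingChoose (p q c d : ℕ) : ℕ := if p = q then (c + d).choose c else 1

theorem leadingChoose_self (p c d : ℕ) : leadingChoose p p c d = (c + d).choose c := if_pos rfl

theorem leadingChoose_of_ne {p q : ℕ} (h : p ≠ q) (c d : ℕ) : leadingChoose p q c d = 1 := if_neg h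

theorem coeff_coeff_prod_piSingle_add_piSingle_pow (p q c d : ℕ) (R : Exponent) :
    ((R.prod fun i e => (Pi.single p (C X) + Pi.single q Y : ℕ → k[X][Y]) i ^ e).coeff d).coeff c =
      Finsupp.single (Finsupp.single p c + Finsupp.single q d) (leadingChoose p q c d : k) R := by
  rcases eq_or_ne p q with rfl | hpq
  · rw [← Pi.single_add, prod_piSingle_pow, ← Finsupp.single_add, leadingChoose_self]
    by_cases hR : R = Finsupp.single p (R p)
    · rw [if_pos hR, coeff_coeff_CX_add_Y_pow, hR, Finsupp.single_eq_same,
        Finsupp.single_apply_left (Finsupp.single_injective p), Finsupp.single_apply]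
      split_ifs with h <;> simp [h]
    · rw [if_neg hR, Finsupp.single_eq_of_ne (by rintro rfl; simp at hR)]
      simp
  · have hg (i : ℕ) (hi : i ≠ q) : (Pi.single p (C X) + Pi.single q Y : ℕ → k[X][Y]) i =
        (Pi.single p (C X) : ℕ → k[X][Y]) i := by
      rw [Pi.add_apply, Pi.single_eq_of_ne hi, add_zero]
    rw [prod_pow_eq_pow_mul_prod_erase hg, prod_piSingle_pow, mul_ite, mul_zero,
      mul_comm (_ ^ _), leadingChoose_of_ne hpq, Nat.cast_one, Finsupp.single_apply,
      Pi.add_apply, Pi.single_eq_of_ne hpq.symm, Pi.single_eq_same, zero_add]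
    simp only [add_single_eq_iff (Finsupp.single_eq_of_ne hpq.symm)]
    by_cases hR : R.erase q = Finsupp.single p (R.erase q p)
    · rw [if_pos hR, coeff_coeff_CX_pow_mul_Y_pow, hR, Finsupp.single_eq_same]
      simp only [(Finsupp.single_injective p).eq_iff, eq_comm, and_comm]
    · rw [if_neg hR, if_neg fun h => hR (by simp [← h.2])]
      simp

variable (k) in
/-- The image of the coproducts of the `ξ_{i+1}` under the substitution that keeps `ξ_{p+1} ⊗ 1 = x`
and `1 ⊗ ξ_{q+1} = y` only. -/
def linCoprod (p q : ℕ) : ℕ → k[X][Y] :=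
  Pi.single p (C X) + Pi.single q Y + Pi.single (p + q + 1) (C X ^ 2 ^ (q + 1) * Y)

variable (k) in
/-- The right hand side of Milnor's formula for the product of `Sq(cΔ_{p+1})` and `Sq(dΔ_{q+1})`,
with the multinomial coefficients taken in `k`. The `j`-th summand comes from the Milnor matrix
whose only entry outside the borders is `j`. -/
def milnorProd (p q c d : ℕ) : Exponent →₀ k :=
  ∑ j ∈ Finset.range (min (c / 2 ^ (q + 1)) d + 1),
    Finsupp.single (Finsupp.single p (c - 2 ^ (q + 1) * j) + Finsupp.single q (d - j) +
      Finsupp.single (p + q + 1) j) (leadingChoose p q (c - 2 ^ (q + 1) * j) (d - j) : k)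

theorem mem_range_min_div {a b c j : ℕ} (hb : 0 < b) :
    j ∈ Finset.range (min (a / b) c + 1) ↔ b * j ≤ a ∧ j ≤ c := by
  rw [Finset.mem_range, Nat.lt_succ_iff, le_min_iff, Nat.le_div_iff_mul_le hb, mul_comm]

theorem coeff_coeff_prod_linCoprod_pow (p q c d : ℕ) (R : Exponent) :
    ((R.prod fun i e => linCoprod k p q i ^ e).coeff d).coeff c = milnorProd k p q c d R := by
  have hg (i : ℕ) (hi : i ≠ p + q + 1) :
      linCoprod k p q i = (Pi.single p (C X) + Pi.single q Y : ℕ → k[X][Y]) i := by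
    rw [linCoprod, Pi.add_apply, Pi.single_eq_of_ne hi, add_zero]
  have hp : p + q + 1 ≠ p := by omega
  have hq : p + q + 1 ≠ q := by omega
  have hm : linCoprod k p q (p + q + 1) = C X ^ 2 ^ (q + 1) * Y := by
    simp [linCoprod, hp, hq]
  have hS (u v : ℕ) :
      (Finsupp.single p u + Finsupp.single q v : Exponent) (p + q + 1) = 0 := by
    simp [hp, hq]
  rw [prod_pow_eq_pow_mul_prod_erase hg, hm, mul_pow, ← pow_mul,
    coeff_coeff_CX_pow_mul_Y_pow_mul, coeff_coeff_prod_piSingle_add_piSingle_pow, milnorProd,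
    Finsupp.finsetSum_apply]
  simp only [Finsupp.single_apply, add_single_eq_iff (hS _ _), ite_and,
    Finset.sum_ite_eq', mem_range_min_div (Nat.two_pow_pos _)]

theorem milnorProd_eq_single {p q c d : ℕ} (h : c < 2 ^ (q + 1) ∨ d = 0) :
    milnorProd k p q c d =
      Finsupp.single (Finsupp.single p c + Finsupp.single q d) (leadingChoose p q c d : k) := by
  have h0 : min (c / 2 ^ (q + 1)) d = 0 := by
    rcases h with h | rfl
    · rw [Nat.div_eq_of_lt h, Nat.zero_min]
    · exact Nat.min_zero _
  simp [milnorProd, h0]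

theorem milnorProd_two_pow_succ (p q d : ℕ) :
    milnorProd k p q (2 ^ (q + 1)) (d + 1) =
      Finsupp.single (Finsupp.single p (2 ^ (q + 1)) + Finsupp.single q (d + 1))
        (leadingChoose p q (2 ^ (q + 1)) (d + 1) : k) +
      Finsupp.single (Finsupp.single q d + Finsupp.single (p + q + 1) 1) 1 := by
  have h1 : min (2 ^ (q + 1) / 2 ^ (q + 1)) (d + 1) = 1 := by
    rw [Nat.div_self (Nat.two_pow_pos _)]
    omega
  rw [milnorProd, h1]
  simp [Finset.sum_range_succ, leadingChoose, -Finsupp.single_tsub]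

end Restriction

section Coproduct

variable {K : Type*} [CommRing K]

theorem ringHom_xi {L : Type*} [CommRing L] (φ : K →+* L) (v : ℕ → K) (n : ℕ) :
    φ (xi v n) = xi (fun i => φ (v i)) n := by
  cases n <;> simp [xi]

theorem ringHom_xiSub {L : Type*} [CommRing L] (φ : K →+* L) (v : ℕ → K) (n k : ℕ) :
    φ (xiSub v n k) = xiSub (fun i => φ (v i)) n k := by
  unfold xiSub
  split_ifs
  · exact ringHom_xi φ v _
  · exact map_zero φ

theorem xi_piSingle (q : ℕ) (y : K) (j : ℕ) :
    xi (Pi.single q y) j = (if j = 0 then 1 else 0) + if j = q + 1 then y else 0 := by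
  cases j <;> simp [xi, Pi.single_apply]

theorem xiSub_piSingle (p : ℕ) (x : K) (n q : ℕ) :
    xiSub (Pi.single p x) n q = (if n = q then 1 else 0) + if n = p + q + 1 then x else 0 := by
  unfold xiSub
  split_ifs with hq <;> grind [xi_piSingle]

theorem sum_xiSub_mul_xi_piSingle (p q : ℕ) (x y : K) (n : ℕ) :
    ∑ j ∈ Finset.range (n + 2),
        xiSub (Pi.single p x) (n + 1) j ^ 2 ^ j * xi (Pi.single q y) j =
      (Pi.single p x + Pi.single q y + Pi.single (p + q + 1) (x ^ 2 ^ (q + 1) * y) : ℕ → K) n := by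
  simp only [xi_piSingle, mul_add, Finset.sum_add_distrib, mul_ite, mul_one, mul_zero,
    Finset.sum_ite_eq', Finset.mem_range, xiSub_piSingle, Pi.add_apply, Pi.single_apply]
  split_ifs <;> first | omega | contradiction | simp

theorem sum_xiSub_mul_xiSub_mul_xi_piSingle (p q : ℕ) (x y : K) {n m : ℕ} (h : n < m) :
    ∑ k ∈ Finset.range (n + 1), xiSub (Pi.single p x) n k ^ 2 ^ k *
        xiSub (Pi.single p x) m k ^ 2 ^ k * xi (Pi.single q y) (k + 1) =
      if n = q ∧ m = p + q + 1 then x ^ 2 ^ q * y else 0 := by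
  simp only [xi, Pi.single_apply, mul_ite, mul_zero, Finset.sum_ite_eq', Finset.mem_range,
    xiSub_piSingle]
  split_ifs <;> first | omega | simp

theorem restrict_coprodA_X (p q n : ℕ) :
    restrict (ZMod 2) p q (coprodA (MvPolynomial.X n)) = linCoprod (ZMod 2) p q n := by
  rw [linCoprod, ← sum_xiSub_mul_xi_piSingle, coprodA, MvPolynomial.aeval_X, map_sum]
  refine Finset.sum_congr rfl fun j _ => ?_
  rw [map_mul, map_pow, ← RingHom.coe_coe (restrict _ _ _), ringHom_xi, ringHom_xiSub]
  simp [restrict]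

theorem restrict_xiL (p q n k : ℕ) :
    restrict (ZMod 4) (Sum.inl p : Idx) (Sum.inl q) (xiL n k) =
      xiSub (Pi.single p (C X : (ZMod 4)[X][Y])) n k := by
  rw [xiL, ← RingHom.coe_coe (restrict _ _ _), ringHom_xiSub]
  exact congrArg (xiSub · n k) (funext fun i => by simp [restrict, Pi.single_apply])

theorem restrict_xiR (p q n : ℕ) :
    restrict (ZMod 4) (Sum.inl p : Idx) (Sum.inl q) (xiR n) =
      xi (Pi.single q (Y : (ZMod 4)[X][Y])) n := by
  rw [xiR, ← RingHom.coe_coe (restrict _ _ _), ringHom_xi]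
  exact congrArg (xi · n) (funext fun i => by simp [restrict, Pi.single_apply])

theorem restrict_xiPairR (p q : ℕ) (r : Pair) :
    restrict (ZMod 4) (Sum.inl p : Idx) (Sum.inl q) (xiPairR r) = 0 := by
  simp [restrict, xiPairR]

theorem restrict_coprodDGen_inl (p q n : ℕ) :
    restrict (ZMod 4) (Sum.inl p : Idx) (Sum.inl q) (coprodDGen (Sum.inl n)) =
      linCoprod (ZMod 4) p q n := by
  rw [linCoprod, ← sum_xiSub_mul_xi_piSingle]
  simp only [coprodDGen, map_add, map_mul, map_sum, map_pow, restrict_xiL, restrict_xiR,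
    restrict_xiPairR, mul_zero, Finset.sum_const_zero, add_zero]

theorem restrict_coprodDGen_inr (p q : ℕ) (r : Pair) :
    restrict (ZMod 4) (Sum.inl p : Idx) (Sum.inl q) (coprodDGen (Sum.inr r)) =
      if r.1.1 = q ∧ r.1.2 = p + q + 1 then C X ^ 2 ^ q * Y else 0 := by
  have hX : restrict (ZMod 4) (Sum.inl p : Idx) (Sum.inl q)
      (MvPolynomial.X (Sum.inl (Sum.inr r))) = 0 := by
    simp [restrict]
  rw [← sum_xiSub_mul_xiSub_mul_xi_piSingle p q _ _ r.2]
  simp only [coprodDGen, map_add, map_mul, map_sum, map_pow, restrict_xiL, restrict_xiR,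
    restrict_xiPairR, mul_zero, Finset.sum_const_zero, add_zero, hX, zero_add]

theorem restrict_coprodA_monomial (p q : ℕ) (R : Exponent) :
    restrict (ZMod 2) p q (coprodA (MvPolynomial.monomial R 1)) =
      R.prod fun i e => linCoprod (ZMod 2) p q i ^ e := by
  simp only [MvPolynomial.monomial_eq, MvPolynomial.C_1, one_mul, map_finsuppProd, map_pow,
    restrict_coprodA_X]

theorem restrict_coprodD_monomial_monoXi (p q : ℕ) (R : Exponent) :
    restrict (ZMod 4) (Sum.inl p : Idx) (Sum.inl q)
        (coprodD (MvPolynomial.monomial (monoXi R) 1)) =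
      R.prod fun i e => linCoprod (ZMod 4) p q i ^ e := by
  rw [coprodD, MvPolynomial.aeval_monomial, map_one, one_mul, monoXi,
    Finsupp.prod_mapDomain_index_inj Sum.inl_injective]
  simp only [map_finsuppProd, map_pow, restrict_coprodDGen_inl]

theorem restrict_coprodD_monomial_monoXiPair (p q : ℕ) (r : Pair) (R : Exponent) :
    restrict (ZMod 4) (Sum.inl p : Idx) (Sum.inl q)
        (coprodD (MvPolynomial.monomial (monoXiPair r R) 1)) =
      (if r.1.1 = q ∧ r.1.2 = p + q + 1 then C X ^ 2 ^ q * Y else 0) *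
        R.prod fun i e => linCoprod (ZMod 4) p q i ^ e := by
  have hr : coprodD (MvPolynomial.X (Sum.inr r)) = coprodDGen (Sum.inr r) :=
    MvPolynomial.aeval_X _ _
  rw [← restrict_coprodD_monomial_monoXi, ← restrict_coprodDGen_inr, ← hr, ← map_mul, ← map_mul,
    monoXiPair, MvPolynomial.X, MvPolynomial.monomial_mul, one_mul]

end Coproduct

section Products

scoped instance : NonUnitalNonAssocRing SteenrodAlgebra where
  __ := (inferInstance : AddCommGroup SteenrodAlgebra)
  __ := (inferInstance : Mul SteenrodAlgebra)
  left_distrib a b c := Finsupp.ext (M := ZMod 2) fun _ => pair2_add_right a b c _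
  right_distrib a b c := Finsupp.ext (M := ZMod 2) fun _ => pair2_add_left a b c _
  zero_mul := zero_mulA
  mul_zero _ := Finsupp.ext (M := ZMod 2) fun _ =>
    Finset.sum_eq_zero fun _ _ => Finsupp.sum_zero_index

scoped instance : Module (ZMod 2) SteenrodAlgebra :=
  AddCommGroup.zmodModule fun _ => Finsupp.ext (M := ZMod 2) fun _ =>
    (two_nsmul _).trans (ZModModule.add_self (G := ZMod 2) _)

scoped instance : Module (ZMod 2) D1 :=
  inferInstanceAs (Module (ZMod 2) (SteenrodAlgebra × SteenrodAlgebra × (Pair →₀ SteenrodAlgebra)))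

theorem single_natCast_eq_nsmul_Sq (R : Exponent) (n : ℕ) :
    (Finsupp.single R (n : ZMod 2) : SteenrodAlgebra) = n • Sq R := by
  rw [← nsmul_one, ← Finsupp.smul_single]
  rfl

theorem Sq_single_mul_Sq_single (p q c d : ℕ) :
    Sq (Finsupp.single p c) * Sq (Finsupp.single q d) = milnorProd (ZMod 2) p q c d := by
  refine Finsupp.ext (M := ZMod 2) fun R => ?_
  rw [← coeff_coeff_prod_linCoprod_pow, ← restrict_coprodA_monomial, coeff_coeff_restrict]
  change pair2 (Finsupp.single _ 1) (Finsupp.single _ 1) _ = _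
  simp [pair2]

theorem Sq_single_mul_Sq_single_eq_nsmul {p q c d : ℕ} (h : c < 2 ^ (q + 1) ∨ d = 0) :
    Sq (Finsupp.single p c) * Sq (Finsupp.single q d) =
      leadingChoose p q c d • Sq (Finsupp.single p c + Finsupp.single q d) := by
  rw [Sq_single_mul_Sq_single, milnorProd_eq_single h, single_natCast_eq_nsmul_Sq]

theorem Sq_single_two_pow_succ_mul_Sq_single (p q d : ℕ) :
    Sq (Finsupp.single p (2 ^ (q + 1))) * Sq (Finsupp.single q (d + 1)) =
      leadingChoose p q (2 ^ (q + 1)) (d + 1) •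
        Sq (Finsupp.single p (2 ^ (q + 1)) + Finsupp.single q (d + 1)) +
      Sq (Finsupp.single q d + Finsupp.single (p + q + 1) 1) := by
  rw [Sq_single_mul_Sq_single, milnorProd_two_pow_succ, ← single_natCast_eq_nsmul_Sq]
  rfl

theorem Sq_zero_mul_Sq_single (n d : ℕ) :
    Sq 0 * Sq (Finsupp.single n d) = Sq (Finsupp.single n d) := by
  have h := Sq_single_mul_Sq_single_eq_nsmul (p := n) (q := n) (c := 0) (d := d)
    (Or.inl (Nat.two_pow_pos _))
  simpa [leadingChoose_self] using h

theorem Sq_single_mul_Sq_zero (n c : ℕ) :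
    Sq (Finsupp.single n c) * Sq 0 = Sq (Finsupp.single n c) := by
  have h := Sq_single_mul_Sq_single_eq_nsmul (p := n) (q := n) (c := c) (Or.inr rfl)
  simpa [leadingChoose_self] using h

theorem Sq_single_mul_Sq_single_self {n c : ℕ} (d : ℕ) (h : c < 2 ^ (n + 1)) :
    Sq (Finsupp.single n c) * Sq (Finsupp.single n d) =
      (c + d).choose c • Sq (Finsupp.single n (c + d)) := by
  rw [Sq_single_mul_Sq_single_eq_nsmul (Or.inl h), leadingChoose_self, Finsupp.single_add]

theorem Sq_single_mul_Sq_single_of_ne {p q c : ℕ} (hpq : p ≠ q) (d : ℕ) (h : c < 2 ^ (q + 1)) :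
    Sq (Finsupp.single p c) * Sq (Finsupp.single q d) =
      Sq (Finsupp.single p c + Finsupp.single q d) := by
  rw [Sq_single_mul_Sq_single_eq_nsmul (Or.inl h), leadingChoose_of_ne hpq, one_smul]

theorem commute_Sq_single {n c d : ℕ} (hc : c < 2 ^ (n + 1)) (hd : d < 2 ^ (n + 1)) :
    Commute (Sq (Finsupp.single n c)) (Sq (Finsupp.single n d)) := by
  rw [Commute, SemiconjBy, Sq_single_mul_Sq_single_self d hc, Sq_single_mul_Sq_single_self c hd,
    add_comm d c, Nat.choose_symm_add]

theorem choose_two_pow_succ_mod_four (s : ℕ) : (2 ^ (s + 1)).choose (2 ^ s) % 4 = 2 := by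
  have hmult : emultiplicity 2 ((2 ^ (s + 1)).choose (2 ^ s)) = (1 : ℕ) := by
    have h := Nat.Prime.emultiplicity_choose_prime_pow_add_emultiplicity Nat.prime_two
      (Nat.pow_le_pow_right two_pos s.le_succ) (pow_ne_zero s two_ne_zero)
    rw [Nat.Prime.emultiplicity_pow_self Nat.prime_two, Nat.cast_succ, add_comm (s : ℕ∞)] at h
    exact ENat.add_left_injective_of_ne_top (ENat.natCast_ne_top s) h
  obtain ⟨hdvd, hndvd⟩ := emultiplicity_eq_coe.1 hmult
  norm_num at hdvd hndvd
  omega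

theorem Sq_single_two_pow_mul_self {n s : ℕ} (hs : s ≤ n) :
    Sq (Finsupp.single n (2 ^ s)) * Sq (Finsupp.single n (2 ^ s)) = 0 := by
  rw [Sq_single_mul_Sq_single_self _ (Nat.pow_lt_pow_right one_lt_two (by omega)), ← mul_two,
    ← pow_succ]
  have heven : 2 ∣ (2 ^ (s + 1)).choose (2 ^ s) := by
    have := choose_two_pow_succ_mod_four s
    omega
  obtain ⟨m, hm⟩ := heven
  rw [hm, mul_nsmul, two_nsmul, ZModModule.add_self, smul_zero]

theorem Sq_single_two_pow_succ_mul_Sq_single_two_pow (n : ℕ) :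
    Sq (Finsupp.single n (2 ^ (n + 1))) * Sq (Finsupp.single n (2 ^ n)) =
      Sq (Finsupp.single n (2 ^ n)) * Sq (Finsupp.single n (2 ^ (n + 1))) +
      Sq (Finsupp.single (2 * n + 1) 1) * Sq (Finsupp.single n (2 ^ n - 1)) := by
  have hprod := Sq_single_two_pow_succ_mul_Sq_single n n (2 ^ n - 1)
  rw [Nat.sub_add_cancel Nat.one_le_two_pow, leadingChoose_self, ← Finsupp.single_add,
    ← two_mul] at hprod
  rw [hprod, Sq_single_mul_Sq_single_self _ (Nat.pow_lt_pow_right one_lt_two n.lt_succ_self),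
    Sq_single_mul_Sq_single_of_ne (by omega) _ (Nat.one_lt_two_pow n.succ_ne_zero),
    add_comm (2 ^ n), Nat.choose_symm_add, add_comm (Finsupp.single n _)]

end Products

section SquareLift

theorem map_milnorProd {k l : Type*} [CommRing k] [CommRing l] (φ : k →+* l) (p q c d : ℕ)
    (R : Exponent) : φ (milnorProd k p q c d R) = milnorProd l p q c d R := by
  simp [milnorProd, Finsupp.finsetSum_apply, Finsupp.single_apply, apply_ite φ]

theorem standardSections_σ_Sq (R : Exponent) :
    standardSections.σ (Sq R) = (Finsupp.single R (1 : ZMod 4), 0) :=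
  Prod.ext (Finsupp.mapRange_single (M := ZMod 2) (hf := lift_zero)) rfl

theorem toDual_σ_Sq (R : Exponent) :
    (standardSections.σ (Sq R)).toDual = Finsupp.single (monoXi R) 1 := by
  rw [standardSections_σ_Sq]
  change Finsupp.mapDomain monoXi (Finsupp.single R (1 : ZMod 4)) + 0 = _
  rw [add_zero, Finsupp.mapDomain_single]

theorem pair2_σ_Sq_single (p q c d : ℕ) (f : MvPolynomial (Idx ⊕ Idx) (ZMod 4)) :
    pair2 (standardSections.σ (Sq (Finsupp.single p c))).toDual
        (standardSections.σ (Sq (Finsupp.single q d))).toDual f =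
      ((restrict (ZMod 4) (Sum.inl p : Idx) (Sum.inl q) f).coeff d).coeff c := by
  rw [toDual_σ_Sq, toDual_σ_Sq, coeff_coeff_restrict]
  simp [pair2, monoXi, Finsupp.mapDomain_single]

/-- The index of the variable `ξ_{q,p+q+1}`, whose coproduct contains `ξ_{p+1}^{2^q} ⊗ ξ_{q+1}`. -/
def mixedPair (p q : ℕ) : Pair := ⟨(q, p + q + 1), by dsimp only; omega⟩

theorem eq_mixedPair_iff {p q : ℕ} {r : Pair} :
    r = mixedPair p q ↔ r.1.1 = q ∧ r.1.2 = p + q + 1 :=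
  Subtype.ext_iff.trans Prod.ext_iff

theorem σ_Sq_single_mul_σ_Sq_single_fst (p q c d : ℕ) :
    (standardSections.σ (Sq (Finsupp.single p c)) *
      standardSections.σ (Sq (Finsupp.single q d))).1 = milnorProd (ZMod 4) p q c d :=
  Finsupp.ext fun R => by
    rw [← coeff_coeff_prod_linCoprod_pow, ← restrict_coprodD_monomial_monoXi]
    exact pair2_σ_Sq_single p q c d _

theorem σ_Sq_single_mul_σ_Sq_single_snd (p q c d : ℕ) :
    (standardSections.σ (Sq (Finsupp.single p c)) *
      standardSections.σ (Sq (Finsupp.single q d))).2 =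
      if 2 ^ q ≤ c ∧ 1 ≤ d then
        Finsupp.single (mixedPair p q)
          (Sq (Finsupp.single p (c - 2 ^ q)) * Sq (Finsupp.single q (d - 1)))
      else 0 := by
  refine Finsupp.ext fun r => Finsupp.ext (M := ZMod 2) fun R => ?_
  refine (congrArg (ZMod.castHom (show 2 ∣ 4 by norm_num) (ZMod 2))
    (pair2_σ_Sq_single p q c d _)).trans ?_
  rw [restrict_coprodD_monomial_monoXiPair]
  by_cases hr : r = mixedPair p q
  · rw [if_pos (eq_mixedPair_iff.1 hr), ← pow_one Y, coeff_coeff_CX_pow_mul_Y_pow_mul,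
      coeff_coeff_prod_linCoprod_pow, apply_ite (ZMod.castHom _ _), map_milnorProd, map_zero]
    split_ifs
    · rw [hr, ← Sq_single_mul_Sq_single, Finsupp.single_eq_same]
    · rfl
  · rw [if_neg (mt eq_mixedPair_iff.2 hr), zero_mul, Polynomial.coeff_zero, Polynomial.coeff_zero,
      map_zero]
    split_ifs
    · rw [Finsupp.single_eq_of_ne hr]
      rfl
    · rfl

theorem σ_Sq_single_two_pow_mul_self_fst {n s : ℕ} (hs : s ≤ n) :
    (standardSections.σ (Sq (Finsupp.single n (2 ^ s))) *
      standardSections.σ (Sq (Finsupp.single n (2 ^ s)))).1 =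
      Finsupp.single (Finsupp.single n (2 ^ (s + 1))) 2 := by
  have htwo : (((2 ^ (s + 1)).choose (2 ^ s) : ℕ) : ZMod 4) = 2 := by
    rw [← ZMod.natCast_mod, choose_two_pow_succ_mod_four]
    rfl
  rw [σ_Sq_single_mul_σ_Sq_single_fst, milnorProd_eq_single
    (Or.inl (Nat.pow_lt_pow_right one_lt_two (by omega))), leadingChoose_self,
    ← Finsupp.single_add, ← mul_two, ← pow_succ, htwo]

theorem σ_Sq_single_two_pow_mul_self_snd {n s : ℕ} (hs : s ≤ n) :
    (standardSections.σ (Sq (Finsupp.single n (2 ^ s))) *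
      standardSections.σ (Sq (Finsupp.single n (2 ^ s)))).2 =
      if s = n then Finsupp.single (mixedPair n n) (Sq (Finsupp.single n (2 ^ n - 1))) else 0 := by
  have hiff : 2 ^ n ≤ 2 ^ s ∧ 1 ≤ 2 ^ s ↔ s = n := by
    rw [Nat.pow_le_pow_iff_right one_lt_two, and_iff_left Nat.one_le_two_pow]
    omega
  rw [σ_Sq_single_mul_σ_Sq_single_snd, if_congr hiff rfl rfl]
  split_ifs with h
  · rw [h, tsub_self, Finsupp.single_zero, Sq_zero_mul_Sq_single]
  · rfl

end SquareLift

section Bimodule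

theorem cont_Sq (S R : Exponent) : cont S (Sq R) = if S ≤ R then Sq (R - S) else 0 := by
  refine Finsupp.ext (M := ZMod 2) fun T => (Finsupp.single_apply (a := R) (a' := S + T)).trans ?_
  split_ifs with hR hle hle
  · rw [hR, add_tsub_cancel_left]
    exact Finsupp.single_eq_same.symm
  · exact absurd (hR ▸ le_self_add) hle
  · refine (Finsupp.single_eq_of_ne ?_).symm
    rintro rfl
    exact hR (add_tsub_cancel_of_le hle).symm
  · rfl

theorem cont_smul_expDelta_Sq_single {n c e : ℕ} (h : e ≤ c) :
    cont (e • expDelta (n + 1)) (Sq (Finsupp.single n c)) = Sq (Finsupp.single n (c - e)) := by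
  rw [expDelta, Finsupp.smul_single, smul_eq_mul, mul_one, cont_Sq,
    if_pos (Finsupp.single_le_single.2 h), ← Finsupp.single_tsub]

theorem cont_Sq_single_of_lt {n c m : ℕ} {S : Exponent} (h : Finsupp.single n c m < S m) :
    cont S (Sq (Finsupp.single n c)) = 0 := by
  rw [cont_Sq, if_neg fun hle => (hle m).not_gt h]

theorem kappa_Sq_single {n : ℕ} (hn : n ≠ 0) (c : ℕ) : kappa (Sq (Finsupp.single n c)) = 0 :=
  cont_Sq_single_of_lt (m := 0) <| by
    rw [Finsupp.single_eq_of_ne hn.symm]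
    simp [expDelta]

theorem maxIndex_Sq_single {n c : ℕ} (hc : c ≠ 0) :
    maxIndex (Sq (Finsupp.single n c)) = n + 1 := by
  unfold maxIndex Sq
  rw [Finsupp.support_single (M := ZMod 2) _ one_ne_zero, Finset.sup_singleton,
    Finsupp.support_single _ hc, Finset.sup_singleton]

theorem D1.mu_add (a b : SteenrodAlgebra) : D1.mu (a + b) = D1.mu a + D1.mu b :=
  Prod.ext (add_zero _).symm (Prod.ext rfl (add_zero _).symm)

theorem D1.incl_add (a b : SteenrodAlgebra) : D1.incl (a + b) = D1.incl a + D1.incl b :=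
  Prod.ext rfl (Prod.ext (add_zero _).symm (add_zero _).symm)

theorem D1.U_of_lt {k l : ℕ} (h : k < l) (a : SteenrodAlgebra) :
    D1.U k l a = (0, 0, Finsupp.single ⟨(k, l), h⟩ a) :=
  dif_pos h

theorem D1.U_of_gt {k l : ℕ} (h : l < k) (a : SteenrodAlgebra) :
    D1.U k l a = D1.incl (Sq (expDelta k + expDelta l) * a) + D1.U l k a := by
  rw [D1.U_of_lt h]
  refine (dif_neg h.asymm).trans ((dif_pos h).trans ?_)
  exact Prod.ext (add_zero _).symm (Prod.ext (add_zero _).symm (zero_add _).symm)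

theorem D1.U_self (k : ℕ) (a : SteenrodAlgebra) :
    D1.U k k a = D1.incl (Sq (2 • expDelta k) * a) + D1.mu (Sq (expDelta (k + 1)) * a) := by
  refine (dif_neg (lt_irrefl k)).trans ((dif_neg (lt_irrefl k)).trans ?_)
  exact Prod.ext (add_zero _).symm (Prod.ext (zero_add _).symm (add_zero _).symm)

theorem D1.U_add_of_lt {k l : ℕ} (h : k < l) (a b : SteenrodAlgebra) :
    D1.U k l (a + b) = D1.U k l a + D1.U k l b := by
  rw [D1.U_of_lt h, D1.U_of_lt h, D1.U_of_lt h, Finsupp.single_add]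
  exact Prod.ext (add_zero _).symm (Prod.ext (add_zero _).symm rfl)

theorem D1.U_add (k l : ℕ) (a b : SteenrodAlgebra) :
    D1.U k l (a + b) = D1.U k l a + D1.U k l b := by
  rcases lt_trichotomy k l with h | rfl | h
  · exact D1.U_add_of_lt h a b
  · simp only [D1.U_self, mul_add, D1.incl_add, D1.mu_add]
    abel
  · simp only [D1.U_of_gt h, D1.U_add_of_lt h, mul_add, D1.incl_add]
    abel

theorem D1.U_zero (k l : ℕ) : D1.U k l 0 = 0 :=
  (AddMonoidHom.mk' (D1.U k l) (D1.U_add k l)).map_zero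

theorem D1.add_rmul (x y : D1) (a : SteenrodAlgebra) :
    (x + y).rmul a = x.rmul a + y.rmul a :=
  Prod.ext (add_mul _ _ a) (Prod.ext (add_mul _ _ a)
    (Finsupp.mapRange_add (hf := zero_mulA a) (fun _ _ => add_mul _ _ a) _ _))

theorem D1.mu_rmul (b a : SteenrodAlgebra) : (D1.mu b).rmul a = D1.mu (b * a) :=
  Prod.ext (zero_mul a) (Prod.ext rfl (Finsupp.mapRange_zero (hf := zero_mulA a)))

theorem D1.U_rmul_of_lt {k l : ℕ} (h : k < l) (b a : SteenrodAlgebra) :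
    (D1.U k l b).rmul a = D1.U k l (b * a) := by
  rw [D1.U_of_lt h, D1.U_of_lt h]
  exact Prod.ext (zero_mul a) (Prod.ext (zero_mul a)
    (Finsupp.mapRange_single (hf := zero_mulA a)))

theorem D1.lmul_add (a : SteenrodAlgebra) (x y : D1) :
    D1.lmul a (x + y) = D1.lmul a x + D1.lmul a y := by
  unfold D1.lmul
  have hsum := Finsupp.sum_add_index' (f := x.2.2) (g := y.2.2)
    (h := fun p b => ∑ i ∈ Finset.range (maxIndex a + 1), ∑ j ∈ Finset.range (maxIndex a + 1),
      D1.U (p.1.1 + i) (p.1.2 + j) (cont (2 ^ p.1.1 • expDelta i + 2 ^ p.1.2 • expDelta j) a * b))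
    (fun p => by simp only [mul_zero, D1.U_zero, Finset.sum_const_zero])
    (fun p b c => by simp only [mul_add, D1.U_add, Finset.sum_add_distrib])
  change _ + Finsupp.sum (x.2.2 + y.2.2) _ = _
  rw [hsum]
  change D1.incl (a * (x.1 + y.1)) + (D1.mu (a * (x.2.1 + y.2.1)) +
    D1.incl (kappa a * (x.2.1 + y.2.1))) + _ = _
  simp only [mul_add, D1.incl_add, D1.mu_add]
  abel

theorem D1.lmul_mu (a b : SteenrodAlgebra) :
    D1.lmul a (D1.mu b) = D1.mu (a * b) + D1.incl (kappa a * b) := by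
  change D1.incl (a * 0) + _ + Finsupp.sum 0 _ = _
  rw [mul_zero, Finsupp.sum_zero_index, add_zero]
  exact zero_add _

theorem D1.lmul_U_of_lt {k l : ℕ} (h : k < l) (a b : SteenrodAlgebra) :
    D1.lmul a (D1.U k l b) =
      ∑ i ∈ Finset.range (maxIndex a + 1), ∑ j ∈ Finset.range (maxIndex a + 1),
        D1.U (k + i) (l + j) (cont (2 ^ k • expDelta i + 2 ^ l • expDelta j) a * b) := by
  rw [D1.U_of_lt h]
  change D1.incl (a * 0) + (D1.mu (a * 0) + D1.incl (kappa a * 0)) + _ = _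
  rw [mul_zero, mul_zero, Finsupp.sum_single_index]
  · exact zero_add _
  · simp only [mul_zero, D1.U_zero, Finset.sum_const_zero]

theorem cont_add_expDelta_Sq_single_of_lt {n c f j : ℕ} (S : Exponent) (hf : c < f) (hj : j ≠ 0) :
    cont (S + f • expDelta j) (Sq (Finsupp.single n c)) = 0 := by
  obtain ⟨m, rfl⟩ := Nat.exists_eq_succ_of_ne_zero hj
  refine cont_Sq_single_of_lt (m := m) ?_
  calc Finsupp.single n c m ≤ c := by
        rw [Finsupp.single_apply]
        split_ifs
        exacts [le_rfl, c.zero_le]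
    _ < f := hf
    _ ≤ (S + f • expDelta (m + 1)) m := by simp [expDelta]

theorem D1.lmul_Sq_single_U {n c k l : ℕ} (h : k < l) (hk : 2 ^ k ≤ c) (hl : c < 2 ^ l)
    (b : SteenrodAlgebra) :
    D1.lmul (Sq (Finsupp.single n c)) (D1.U k l b) =
      D1.U k l (Sq (Finsupp.single n c) * b) +
      D1.U (k + (n + 1)) l (Sq (Finsupp.single n (c - 2 ^ k)) * b) := by
  have hc : c ≠ 0 := ((Nat.two_pow_pos k).trans_le hk).ne'
  rw [D1.lmul_U_of_lt h, maxIndex_Sq_single hc]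
  have hj (i : ℕ) : ∑ j ∈ Finset.range (n + 1 + 1), D1.U (k + i) (l + j)
      (cont (2 ^ k • expDelta i + 2 ^ l • expDelta j) (Sq (Finsupp.single n c)) * b) =
      D1.U (k + i) l (cont (2 ^ k • expDelta i) (Sq (Finsupp.single n c)) * b) := by
    rw [Finset.sum_eq_single_of_mem 0 (by simp) fun j _ hj0 => by
      rw [cont_add_expDelta_Sq_single_of_lt _ hl hj0, zero_mul, D1.U_zero]]
    rw [expDelta, smul_zero, add_zero, add_zero]
  have hi (i : ℕ) (hi0 : i ≠ 0) (hin : i ≠ n + 1) :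
      cont (2 ^ k • expDelta i) (Sq (Finsupp.single n c)) = 0 := by
    obtain ⟨m, rfl⟩ := Nat.exists_eq_succ_of_ne_zero hi0
    refine cont_Sq_single_of_lt (m := m) ?_
    rw [Finsupp.single_eq_of_ne (by omega)]
    simp [expDelta]
  rw [Finset.sum_congr rfl fun i _ => hj i, Finset.sum_eq_add_of_mem 0 (n + 1) (by simp) (by simp)
    n.succ_ne_zero.symm fun i _ h => by rw [hi i h.1 h.2, zero_mul, D1.U_zero],
    cont_smul_expDelta_Sq_single hk, expDelta, smul_zero, add_zero, cont_Sq, if_pos zero_le,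
    tsub_zero]

end Bimodule

section Bracket

theorem D0.mul_eq_zero_of_pair2_eq_zero {d e : D0}
    (h : ∀ f, pair2 d.toDual e.toDual f = 0) : d * e = 0 :=
  Prod.ext (Finsupp.ext (M := ZMod 4) fun _ => h _)
    (Finsupp.ext fun _ => Finsupp.ext (M := ZMod 2) fun _ =>
      (congrArg (ZMod.castHom (show 2 ∣ 4 by norm_num) (ZMod 2)) (h _)).trans (map_zero _))

scoped instance : MulZeroClass D0 where
  __ := (inferInstance : Mul D0)
  __ := (inferInstance : Zero D0)
  zero_mul _ := D0.mul_eq_zero_of_pair2_eq_zero fun _ => Finsupp.sum_zero_index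
  mul_zero _ := D0.mul_eq_zero_of_pair2_eq_zero fun _ =>
    Finset.sum_eq_zero fun _ _ => Finsupp.sum_zero_index

theorem Sections.tau_eq_zero (S : Sections) {a b : SteenrodAlgebra}
    (h : S.σ (a * b) = S.σ a * S.σ b) : S.tau a b = 0 :=
  (congrArg S.u (Subtype.ext (sub_eq_zero.2 h))).trans (map_zero S.u)

theorem Sections.tau_zero_left (S : Sections) (a : SteenrodAlgebra) : S.tau 0 a = 0 :=
  S.tau_eq_zero <| by rw [zero_mul, S.σ_zero, zero_mul]

theorem Sections.tau_zero_right (S : Sections) (a : SteenrodAlgebra) : S.tau a 0 = 0 :=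
  S.tau_eq_zero <| by rw [mul_zero, S.σ_zero, mul_zero]

theorem Sections.bracket_self (S : Sections) {a : SteenrodAlgebra} (h : a * a = 0) :
    S.bracket a a a = (S.tau a a).rmul a + D1.lmul a (S.tau a a) := by
  rw [Sections.bracket, h, S.tau_zero_left, S.tau_zero_right, S.proj_σ, zero_sub, sub_zero,
    ZModModule.neg_eq_self]

theorem standardSections_tau_of_mul_eq_zero {a b : SteenrodAlgebra} (h : a * b = 0) :
    standardSections.tau a b =
      (0, Finsupp.mapRange half half_zero (-(standardSections.σ a * standardSections.σ b).1),
        -(standardSections.σ a * standardSections.σ b).2) := by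
  have hσ : standardSections.σ (a * b) - standardSections.σ a * standardSections.σ b =
      -(standardSections.σ a * standardSections.σ b) := by
    rw [h, standardSections.σ_zero, zero_sub]
  exact congrArg (fun d : D0 => ((0, Finsupp.mapRange half half_zero d.1, d.2) : D1)) hσ

theorem tau_Sq_single {n s : ℕ} (hs : s ≤ n) :
    standardSections.tau (Sq (Finsupp.single n (2 ^ s))) (Sq (Finsupp.single n (2 ^ s))) =
      D1.mu (Sq (Finsupp.single n (2 ^ (s + 1)))) +
        if s = n then D1.U n (2 * n + 1) (Sq (Finsupp.single n (2 ^ n - 1))) else 0 := by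
  have hpair : mixedPair n n = ⟨(n, 2 * n + 1), by dsimp only; omega⟩ :=
    Subtype.ext (Prod.ext rfl (congrArg (· + 1) (two_mul n).symm))
  have hhalf : half (-2) = 1 := by decide
  rw [standardSections_tau_of_mul_eq_zero (Sq_single_two_pow_mul_self hs),
    σ_Sq_single_two_pow_mul_self_fst hs, σ_Sq_single_two_pow_mul_self_snd hs,
    ← Finsupp.single_neg, Finsupp.mapRange_single, hhalf, ZModModule.neg_eq_self]
  by_cases h : s = n
  · rw [if_pos h, if_pos h, D1.U_of_lt (by omega), ← hpair]
    exact Prod.ext (add_zero _).symm (Prod.ext (add_zero _).symm (zero_add _).symm)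
  · rw [if_neg h, if_neg h]
    exact (add_zero (D1.mu _)).symm

theorem bracket_Sq_single_of_lt {n s : ℕ} (hs : s < n) :
    standardSections.bracket (Sq (Finsupp.single n (2 ^ s))) (Sq (Finsupp.single n (2 ^ s)))
      (Sq (Finsupp.single n (2 ^ s))) = 0 := by
  have hcomm := commute_Sq_single (n := n) (c := 2 ^ (s + 1)) (d := 2 ^ s)
    (Nat.pow_lt_pow_right one_lt_two (by omega)) (Nat.pow_lt_pow_right one_lt_two (by omega))
  rw [Sections.bracket_self _ (Sq_single_two_pow_mul_self hs.le), tau_Sq_single hs.le,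
    if_neg hs.ne, add_zero, D1.mu_rmul, D1.lmul_mu, kappa_Sq_single (by omega), zero_mul, hcomm.eq,
    ← add_assoc, ZModModule.add_self, zero_add]
  rfl

theorem bracket_Sq_single_top (n : ℕ) :
    standardSections.bracket (Sq (Finsupp.single n (2 ^ n))) (Sq (Finsupp.single n (2 ^ n)))
      (Sq (Finsupp.single n (2 ^ n))) =
    D1.incl (kappa (Sq (Finsupp.single n (2 ^ n))) * Sq (Finsupp.single n (2 ^ (n + 1))) +
      Sq (2 • expDelta (2 * n + 1)) * Sq (Finsupp.single n (2 ^ n - 1))) := by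
  have hlt : n < 2 * n + 1 := by omega
  have hcomm := commute_Sq_single (n := n) (c := 2 ^ n - 1) (d := 2 ^ n)
    ((Nat.sub_le _ _).trans_lt (Nat.pow_lt_pow_right one_lt_two n.lt_succ_self))
    (Nat.pow_lt_pow_right one_lt_two n.lt_succ_self)
  have hlmul := D1.lmul_Sq_single_U (n := n) hlt (le_refl (2 ^ n))
    (Nat.pow_lt_pow_right one_lt_two hlt) (Sq (Finsupp.single n (2 ^ n - 1)))
  rw [tsub_self, Finsupp.single_zero, Sq_zero_mul_Sq_single, ← add_assoc, ← two_mul,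
    D1.U_self,
    show expDelta (2 * n + 1 + 1) = Finsupp.single (2 * n + 1) 1 from rfl] at hlmul
  rw [Sections.bracket_self _ (Sq_single_two_pow_mul_self le_rfl), tau_Sq_single le_rfl,
    if_pos rfl, D1.add_rmul, D1.lmul_add, D1.mu_rmul, D1.U_rmul_of_lt hlt, D1.lmul_mu, hlmul,
    hcomm.eq, Sq_single_two_pow_succ_mul_Sq_single_two_pow, D1.mu_add, D1.incl_add]
  abel_nf
  simp only [two_zsmul, ZModModule.add_self, zero_add]

theorem P_succ (n s : ℕ) : P (n + 1) s = Sq (Finsupp.single n (2 ^ s)) := by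
  rw [P, expDelta, Finsupp.smul_single, smul_eq_mul, mul_one]

theorem bracket_P_of_lt {t s : ℕ} (h : s + 1 < t) :
    standardSections.bracket (P t s) (P t s) (P t s) = 0 := by
  obtain ⟨n, rfl⟩ := Nat.exists_eq_succ_of_ne_zero (show t ≠ 0 by omega)
  rw [P_succ]
  exact bracket_Sq_single_of_lt (by omega)

theorem bracket_P_top {t : ℕ} (ht : 2 ≤ t) :
    standardSections.bracket (P t (t - 1)) (P t (t - 1)) (P t (t - 1)) =
      D1.incl (Sq ((2 ^ (t - 1) - 1) • expDelta t + 2 • expDelta (2 * t - 1))) := by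
  obtain ⟨n, rfl⟩ := Nat.exists_eq_succ_of_ne_zero (show t ≠ 0 by omega)
  have htwo : 2 < 2 ^ (n + 1) :=
    (pow_one 2).symm.trans_lt (Nat.pow_lt_pow_right one_lt_two (by omega))
  rw [Nat.succ_eq_add_one, Nat.add_sub_cancel, P_succ, bracket_Sq_single_top,
    kappa_Sq_single (by omega), zero_mul, zero_add, show 2 * (n + 1) - 1 = 2 * n + 1 by omega,
    add_comm (_ • _)]
  simp only [expDelta, Finsupp.smul_single, smul_eq_mul, mul_one]
  rw [Sq_single_mul_Sq_single_of_ne (by omega) _ htwo]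

theorem bracket_P_one_zero : standardSections.bracket (P 1 0) (P 1 0) (P 1 0) = 0 := by
  have hkappa : kappa (Sq (Finsupp.single 0 1)) = Sq 0 := by
    rw [kappa, expDelta, cont_Sq, if_pos le_rfl, tsub_self]
  rw [P_succ, bracket_Sq_single_top, pow_zero, hkappa, Sq_zero_mul_Sq_single, tsub_self,
    Finsupp.single_zero, expDelta, Finsupp.smul_single, Sq_single_mul_Sq_zero]
  simp only [zero_add, pow_one, mul_zero, smul_eq_mul, mul_one, ZModModule.add_self]
  rfl

end Bracket

end

end SecondarySteenrod

theorem mainTheorem2 :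
    (∀ t s : ℕ, 1 ≤ t → s + 1 < t →
      standardSections.bracket (P t s) (P t s) (P t s) = 0 ∧
      0 ∈ massey (P t s) (P t s) (P t s)) ∧
    (∀ t : ℕ, 2 ≤ t →
      standardSections.bracket (P t (t - 1)) (P t (t - 1)) (P t (t - 1)) =
        D1.incl (Sq ((2 ^ (t - 1) - 1) • expDelta t + 2 • expDelta (2 * t - 1))) ∧
      Sq ((2 ^ (t - 1) - 1) • expDelta t + 2 • expDelta (2 * t - 1)) ∈
        massey (P t (t - 1)) (P t (t - 1)) (P t (t - 1))) ∧
    (standardSections.bracket (P 1 0) (P 1 0) (P 1 0) = 0 ∧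
      0 ∈ massey (P 1 0) (P 1 0) (P 1 0)) ∧
    (standardSections.bracket (Sq (2 • expDelta 2)) (Sq (2 • expDelta 2)) (Sq (2 • expDelta 2)) =
        D1.incl (Sq (expDelta 2 + 2 • expDelta 3)) ∧
      Sq (expDelta 2 + 2 • expDelta 3) ∈
        massey (Sq (2 • expDelta 2)) (Sq (2 • expDelta 2)) (Sq (2 • expDelta 2))) := by
  have bracket_low {t s : ℕ} (h : s + 1 < t) := SecondarySteenrod.bracket_P_of_lt h
  have bracket_top {t : ℕ} (ht : 2 ≤ t) := SecondarySteenrod.bracket_P_top ht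
  have bracket_Sq1 := SecondarySteenrod.bracket_P_one_zero
  have bracket_Sq02 := bracket_top le_rfl
  simp only [P, Nat.reduceSub, Nat.reduceMul, pow_one, one_smul] at bracket_Sq02
  exact ⟨fun t s _ h => ⟨bracket_low h, standardSections, bracket_low h⟩,
    fun t ht => ⟨bracket_top ht, standardSections, bracket_top ht⟩,
    ⟨bracket_Sq1, standardSections, bracket_Sq1⟩,
    bracket_Sq02, standardSections, bracket_Sq02⟩
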